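/- **Conventions.** For $0<q<\infty$ and an interval $(a,c)$ let $\|g\|_{q,(a,c)}=\big(\int_a^c |g(u)|^q\,du\big)^{1/q}\in[0,\infty]$. For nonnegative functions $g,h$ on $(0,\infty)$, $g\approx h$ means $c\,h(t)\le g(t)\le C\,h(t)$ for all $t>0$ with constants $c,C>0$. A Lebesgue measurable $b:(0,\infty)\to(0,\infty)$ is slowly varying, $b\in SV$, if for every $\varepsilon>0$ the function $t^{\varepsilon}b(t)$ is equivalent ($\approx$) to a positive non-decreasing function and $t^{-\varepsilon}b(t)$ is equivalent to a positive non-increasing function on $(0,\infty)$. We write $b\in SV_{0,q}$ if $b\in SV$ and $\|u^{-1/q}b(u)\|_{q,(1,\infty)}<\infty$. For quasi-normed spaces $A_0,A_1$ inside a common vector space, $K(t,f;A_0,A_1)=\inf\{\|f_0\|_{A_0}+t\|f_1\|_{A_1}: f=f_0+f_1,\ f_j\in A_j\}$, and $(A_0,A_1)_{\theta,q;b}$ is the space of all $f\in A_0+A_1$ for which $\|f\|_{\theta,q;b}=\|t^{-\theta-1/q}b(t)K(t,f;A_0,A_1)\|_{q,(0,\infty)}$ is finite. Let $(\Omega,\mu)$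 be a $\sigma$-finite measure space, and for a real measurable function $f$ on $\Omega$ (functions equal $\mu$-a.e. being identified) let $f^*(t)=\inf\{\lambda\ge 0:\mu\{|f|>\lambda\}\le t\}$. The generalized gamma space $\Gamma(r,q,p;b,w)$ consists of all $f$ for which $$\|f\|_{\Gamma(r,q,p;b,w)}=\Big\|t^{-1/q}b(t)\,\big\|\tau^{1/p-1/r}w(\tau)f^*(\tau)\big\|_{r,(0,t)}\Big\|_{q,(0,\infty)}$$ is finite. **Theorem.** Let $0<q_0,q_1<\infty$, $q_0\ne q_1$, $0<q,p,r<\infty$, $0<\theta<1$, $b_0\in SV_{0,q_0}$, $b_1\in SV_{0,q_1}$ and $b,w\in SV$. For $t>0$ and $\epsilon>0$ put $$\rho(t)=\frac{\|u^{-1/q_0}b_0(u)\|_{q_0,(t,\infty)}}{\|u^{-1/q_1}b_1(u)\|_{q_1,(t,\infty)}},\qquad \rho_\epsilon(t)=\frac{\|u^{-1/q_0}b_0(u)\|_{q_0,(t,\infty)}^{1+\epsilon}}{\|u^{-1/q_1}b_1(u)\|_{q_1,(t,\infty)}}.$$ Assume that for some $\epsilon>0$ the function $\rho_\epsilon$ is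 equivalent to a non-decreasing function on $(0,\infty)$, and that $\rho$ is non-decreasing on $(0,\infty)$ with $\lim_{t\to0^+}\rho(t)=0$ and $\lim_{t\to\infty}\rho(t)=\infty$. Put $$\tilde b(t)=\rho(t)^{1-\theta}\,b(\rho(t))\,b_1(t)^{q_1/q}\Big(\int_t^\infty b_1(u)^{q_1}\frac{du}{u}\Big)^{1/q_1-1/q},\qquad t>0.$$ Then, with equivalent quasi-norms, $$\big(\Gamma(r,q_0,p;b_0,w),\,\Gamma(r,q_1,p;b_1,w)\big)_{\theta,q;b}=\Gamma(r,q,p;\tilde b,w).$$ Moreover, $\tilde b\in SV_{0,q}$ whenever $b\circ\rho$ is Lebesgue measurable (in particular if $b$ is a Borel function); if $b\circ\rho$ is not measurable, the integral in $\|\cdot\|_{\Gamma(r,q,p;\tilde b,w)}$ is read as a lower integral. -/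

import Mathlib

noncomputable section

namespace GenGamma

open MeasureTheory Set
open scoped ENNReal

/-- The `L^q`-quasi-norm `(∫_s g(u)^q du)^{1/q}` (Lebesgue measure on `s ⊆ ℝ`, `0 < q < ∞`) of a
nonnegative function `g`, with values in `[0, ∞]`. -/
def lqNorm (q : ℝ) (s : Set ℝ) (g : ℝ → ℝ≥0∞) : ℝ≥0∞ :=
  (∫⁻ u in s, g u ^ q) ^ (1 / q)

/-- `f ≈ g` on `(0, ∞)`: two-sided estimate with positive constants. -/
def Equivalent (f g : ℝ → ℝ) : Prop :=
  ∃ c > 0, ∃ C > 0, ∀ t : ℝ, 0 < t → c * g t ≤ f t ∧ f t ≤ C * g t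

/-- Slowly varying functions on `(0, ∞)` (the class `SV`): positive, Lebesgue measurable, and for
every `ε > 0`, `t^ε b(t)` is equivalent to a positive non-decreasing function and `t^{-ε} b(t)` to
a positive non-increasing one. Values off `(0, ∞)` are irrelevant. -/
structure IsSV (b : ℝ → ℝ) : Prop where
  pos : ∀ t, 0 < t → 0 < b t
  aemeasurable : AEMeasurable b (volume.restrict (Ioi 0))
  equiv_mono : ∀ ε : ℝ, 0 < ε → ∃ g : ℝ → ℝ, (∀ t, 0 < t → 0 < g t) ∧ MonotoneOn g (Ioi 0) ∧
    Equivalent (fun t => t ^ ε * b t) g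
  equiv_anti : ∀ ε : ℝ, 0 < ε → ∃ g : ℝ → ℝ, (∀ t, 0 < t → 0 < g t) ∧ AntitoneOn g (Ioi 0) ∧
    Equivalent (fun t => t ^ (-ε) * b t) g

/-- `‖u^{-1/q} b(u)‖_{q,(t,∞)}` in `[0, ∞]`. -/
def tailENorm (q : ℝ) (b : ℝ → ℝ) (t : ℝ) : ℝ≥0∞ :=
  lqNorm q (Ioi t) (fun u => ENNReal.ofReal (u ^ (-(1 / q)) * b u))

/-- The class `SV_{0,q}`: `b ∈ SV` with `‖u^{-1/q} b(u)‖_{q,(1,∞)} < ∞`. -/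
structure IsSV0 (q : ℝ) (b : ℝ → ℝ) : Prop where
  isSV : IsSV b
  tail_lt_top : tailENorm q b 1 < ∞

/-- `‖u^{-1/q} b(u)‖_{q,(t,∞)}` as a real number (it is finite for `t > 0` and `b ∈ SV_{0,q}`). -/
def tailNorm (q : ℝ) (b : ℝ → ℝ) (t : ℝ) : ℝ :=
  (tailENorm q b t).toReal

/-- `ρ(t) = ‖u^{-1/q₀} b₀(u)‖_{q₀,(t,∞)} / ‖u^{-1/q₁} b₁(u)‖_{q₁,(t,∞)}`. -/
def rho (q₀ q₁ : ℝ) (b₀ b₁ : ℝ → ℝ) (t : ℝ) : ℝ :=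
  tailNorm q₀ b₀ t / tailNorm q₁ b₁ t

/-- `ρ_ε(t) = ‖u^{-1/q₀} b₀(u)‖_{q₀,(t,∞)}^{1+ε} / ‖u^{-1/q₁} b₁(u)‖_{q₁,(t,∞)}`. -/
def rhoEps (q₀ q₁ : ℝ) (b₀ b₁ : ℝ → ℝ) (ε t : ℝ) : ℝ :=
  tailNorm q₀ b₀ t ^ (1 + ε) / tailNorm q₁ b₁ t

/-- For some `ε > 0`, the function `ρ_ε` is equivalent to a non-decreasing function. -/
def RhoCondition (q₀ q₁ : ℝ) (b₀ b₁ : ℝ → ℝ) : Prop :=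
  ∃ ε : ℝ, 0 < ε ∧ ∃ g : ℝ → ℝ, MonotoneOn g (Ioi 0) ∧ Equivalent (rhoEps q₀ q₁ b₀ b₁ ε) g

/-- `b̃(t) = ρ(t)^{1-θ} b(ρ(t)) b₁(t)^{q₁/q} (∫_t^∞ b₁(u)^{q₁} du/u)^{1/q₁-1/q}`. -/
def bTilde (q₀ q₁ q θ : ℝ) (b₀ b₁ b : ℝ → ℝ) (t : ℝ) : ℝ :=
  rho q₀ q₁ b₀ b₁ t ^ (1 - θ) * b (rho q₀ q₁ b₀ b₁ t) * b₁ t ^ (q₁ / q) *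
    (∫ u in Ioi t, b₁ u ^ q₁ / u) ^ (1 / q₁ - 1 / q)

section Interpolation

variable {V : Type*} [AddCommGroup V]

/-- The set of vectors of finite quasi-norm. A quasi-normed space inside `V` is given by its
quasi-norm, extended by `∞` to the rest of `V`. -/
def finiteSet (N : V → ℝ≥0∞) : Set V :=
  {f | N f < ∞}

/-- The sum `A₀ + A₁` of two quasi-normed spaces inside `V`. -/
def sumSet (N₀ N₁ : V → ℝ≥0∞) : Set V :=
  {f | ∃ f₀ ∈ finiteSet N₀, ∃ f₁ ∈ finiteSet N₁, f = f₀ + f₁}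

/-- The `K`-functional
`K(t, f; A₀, A₁) = inf {‖f₀‖ + t ‖f₁‖ : f₀ ∈ A₀, f₁ ∈ A₁, f = f₀ + f₁}`. -/
def kFunctional (N₀ N₁ : V → ℝ≥0∞) (t : ℝ) (f : V) : ℝ≥0∞ :=
  ⨅ (f₀ : V) (_ : f₀ ∈ finiteSet N₀) (f₁ : V) (_ : f₁ ∈ finiteSet N₁) (_ : f = f₀ + f₁),
    N₀ f₀ + ENNReal.ofReal t * N₁ f₁

/-- The quasi-norm `‖t^{-θ-1/q} b(t) K(t, f; A₀, A₁)‖_{q,(0,∞)}`. -/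
def interpNorm (N₀ N₁ : V → ℝ≥0∞) (θ q : ℝ) (b : ℝ → ℝ) (f : V) : ℝ≥0∞ :=
  lqNorm q (Ioi 0)
    (fun t => ENNReal.ofReal (t ^ (-θ - 1 / q) * b t) * kFunctional N₀ N₁ t f)

/-- The `K`-interpolation space `(A₀, A₁)_{θ,q;b}`. -/
def interpSpace (N₀ N₁ : V → ℝ≥0∞) (θ q : ℝ) (b : ℝ → ℝ) : Set V :=
  {f | f ∈ sumSet N₀ N₁ ∧ interpNorm N₀ N₁ θ q b f < ∞}

end Interpolation

section Gamma

variable {Ω : Type*} [MeasurableSpace Ω] {μ : Measure Ω}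

/-- The non-increasing rearrangement `f^*(t) = inf {λ ≥ 0 : μ{|f| > λ} ≤ t}`. -/
def rearrangement (f : Ω →ₘ[μ] ℝ) (t : ℝ) : ℝ≥0∞ :=
  sInf {l : ℝ≥0∞ | μ {x | l < ‖f x‖ₑ} ≤ ENNReal.ofReal t}

/-- The quasi-norm
`‖ t^{-1/q} b(t) ‖τ^{1/p-1/r} w(τ) f^*(τ)‖_{r,(0,t)} ‖_{q,(0,∞)}` of `Γ(r,q,p;b,w)`. -/
def gammaNorm (r q p : ℝ) (b w : ℝ → ℝ) (f : Ω →ₘ[μ] ℝ) : ℝ≥0∞ :=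
  lqNorm q (Ioi 0) (fun t => ENNReal.ofReal (t ^ (-(1 / q)) * b t) *
    lqNorm r (Ioo 0 t) (fun τ => ENNReal.ofReal (τ ^ (1 / p - 1 / r) * w τ) * rearrangement f τ))

variable (μ) in
/-- The generalized gamma space `Γ(r,q,p;b,w)` of (classes of) real measurable functions. -/
def gammaSpace (r q p : ℝ) (b w : ℝ → ℝ) : Set (Ω →ₘ[μ] ℝ) :=
  finiteSet (gammaNorm r q p b w)

end Gamma

end GenGamma

end

noncomputable section

namespace GenGamma

open MeasureTheory Set
open scoped ENNReal

/-! Write F(t) for the inner norm of f over (0,t) and a_j for the tail norm of b_j, so that ρ =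
a_0/a_1. The K-functional at ρ(t) has two one-sided estimates. From below, K(ρ(t),f) dominates
a_0(t)F(t): the inner norm is quasi-subadditive, a_j(t) times the inner norm of g is at most the
j-th gamma norm of g because inner norms increase, and a_0 = ρ a_1 (`le_kFunctional_rho`). From
above, truncating f at the height f^*(t) bounds K(ρ(t),f) by (∫_0^t b_0^{q_0} F^{q_0} du/u)^{1/q_0}
+ ρ(t)(∫_t^∞ b_1^{q_1} F^{q_1} du/u)^{1/q_1}, up to a constant (`kFunctional_rho_le`).

The two bounds differ pointwise but agree after the summation hidden in the interpolation norm. The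
condition on ρ_ε yields points t_k at which a_1 drops by an exact factor M while ρ grows by a factor
between 2 and M (`exists_grid`). Along them the interpolation norm becomes Σ V_k K(ρ(t_k),f)^q with
V_k = ρ(t_k)^{-θq} b(ρ(t_k))^q (`interpNorm_discrete`). The lower estimate produces Σ W_k F(t_k)^q
with W_k = V_k a_0(t_k)^q. The upper one produces sums that a discrete Hardy inequality
(`tsum_hardy`) reduces to the same expression: V_k decays geometrically because θ > 0, and V_k
ρ(t_k)^q grows geometrically because θ < 1.

The weight b̃ is made for the same sum: b̃^q equals W a_1^{-q_1} b_1^{q_1}, with W the continuous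
form of W_k. The factor W a_1^{-q_1} is essentially constant on each block, and b_1^{q_1} du/u gives
the block a mass comparable to a_1(t_k)^{q_1}; so the gamma norm is also Σ W_k F(t_k)^q up to
constants (`bTilde_discrete`).

The function b∘ρ need not be measurable, so integrals against b̃ are handled only by rules valid for
lower integrals: monotonicity, splitting over measurable sets, and extraction of finite constants.
-/

/-- Two real numbers are comparable up to the factor `C`. -/
def Cmp (C x y : ℝ) : Prop :=
  x ≤ C * y ∧ y ≤ C * x

namespace Cmp

variable {C D x y z x' y' : ℝ}

theorem symm (h : Cmp C x y) : Cmp C y x :=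
  ⟨h.2, h.1⟩

theorem const_pos (hx : 0 < x) (hy : 0 < y) (h : Cmp C x y) : 0 < C := by
  by_contra! hC
  have := h.1
  nlinarith

theorem one_le (hx : 0 < x) (hy : 0 < y) (h : Cmp C x y) : 1 ≤ C := by
  have hC := h.const_pos hx hy
  by_contra! hC1
  have h1 := h.1
  have h2 := h.2
  nlinarith

theorem mono (hx : 0 < x) (hy : 0 < y) (h : Cmp C x y) (hCD : C ≤ D) : Cmp D x y :=
  ⟨h.1.trans (by gcongr), h.2.trans (by gcongr)⟩

theorem mul (hx : 0 < x) (hy : 0 < y) (hx' : 0 < x') (hy' : 0 < y')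
    (h : Cmp C x y) (h' : Cmp D x' y') : Cmp (C * D) (x * x') (y * y') := by
  have hC := h.const_pos hx hy
  have hD := h'.const_pos hx' hy'
  constructor
  · calc x * x' ≤ (C * y) * (D * y') := by gcongr <;> [exact h.1; exact h'.1]
      _ = _ := by ring
  · calc y * y' ≤ (C * x) * (D * x') := by gcongr <;> [exact h.2; exact h'.2]
      _ = _ := by ring

theorem rpow (hx : 0 < x) (hy : 0 < y) (h : Cmp C x y) (e : ℝ) :
    Cmp (C ^ |e|) (x ^ e) (y ^ e) := by
  have hC := h.const_pos hx hy
  have key : ∀ {u v : ℝ}, 0 < u → 0 < v → u ≤ C * v → v ≤ C * u →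
      u ^ e ≤ C ^ |e| * v ^ e := by
    intro u v hu hv h1 h2
    rcases le_total 0 e with he | he
    · rw [abs_of_nonneg he, ← Real.mul_rpow hC.le hv.le]
      exact Real.rpow_le_rpow hu.le h1 he
    · rw [abs_of_nonpos he]
      have h3 : (C * u) ^ e ≤ v ^ e := Real.rpow_le_rpow_of_nonpos hv h2 he
      rw [Real.mul_rpow hC.le hu.le] at h3
      calc u ^ e = C ^ (-e) * (C ^ e * u ^ e) := by
            rw [← mul_assoc, ← Real.rpow_add hC]; simp
        _ ≤ _ := by gcongr
  exact ⟨key hx hy h.1 h.2, key hy hx h.2 h.1⟩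

end Cmp

/-! ### Slowly varying functions through Potter bounds. -/

/-- A quantitative two-sided (Potter type) form of slow variation. -/
structure Potter (b : ℝ → ℝ) : Prop where
  pos : ∀ t, 0 < t → 0 < b t
  cmp : ∀ ε : ℝ, 0 < ε → ∃ C > 0, ∀ D x y : ℝ, 0 < x → 0 < y → Cmp D x y →
    Cmp (C * D ^ ε) (b x) (b y)

namespace Potter

variable {b b' : ℝ → ℝ}

theorem of_le (hpos : ∀ t, 0 < t → 0 < b t)
    (h : ∀ ε : ℝ, 0 < ε → ∃ C > 0, ∀ s t : ℝ, 0 < s → s ≤ t →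
      Cmp (C * (t / s) ^ ε) (b s) (b t)) : Potter b := by
  refine ⟨hpos, fun ε hε => ?_⟩
  obtain ⟨C, hC, H⟩ := h ε hε
  refine ⟨C, hC, ?_⟩
  have key : ∀ D x y : ℝ, 0 < x → x ≤ y → Cmp D x y → Cmp (C * D ^ ε) (b x) (b y) := by
    intro D x y hx hxy hD
    have hy := hx.trans_le hxy
    refine (H x y hx hxy).mono (hpos x hx) (hpos y hy) ?_
    have : y / x ≤ D := (div_le_iff₀ hx).2 hD.2
    gcongr
  intro D x y hx hy hD
  rcases le_total x y with hxy | hxy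
  · exact key D x y hx hxy hD
  · exact (key D y x hy hxy hD.symm).symm

theorem mul (h : Potter b) (h' : Potter b') : Potter (fun t => b t * b' t) := by
  refine ⟨fun t ht => mul_pos (h.pos t ht) (h'.pos t ht), fun ε hε => ?_⟩
  obtain ⟨C, hC, H⟩ := h.cmp (ε / 2) (by positivity)
  obtain ⟨C', hC', H'⟩ := h'.cmp (ε / 2) (by positivity)
  refine ⟨C * C', by positivity, fun D x y hx hy hD => ?_⟩
  have hDp := hD.const_pos hx hy
  have := (H D x y hx hy hD).mul (h.pos x hx) (h.pos y hy) (h'.pos x hx) (h'.pos y hy)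
    (H' D x y hx hy hD)
  convert this using 1
  have : D ^ ε = D ^ (ε / 2) * D ^ (ε / 2) := by rw [← Real.rpow_add hDp]; ring_nf
  rw [this]; ring

theorem rpow (h : Potter b) (e : ℝ) : Potter (fun t => b t ^ e) := by
  refine ⟨fun t ht => Real.rpow_pos_of_pos (h.pos t ht) e, fun ε hε => ?_⟩
  -- Dividing by |e| + 1 instead of |e| also covers e = 0.
  have he : 0 < |e| + 1 := by positivity
  obtain ⟨C, hC, H⟩ := h.cmp (ε / (|e| + 1)) (by positivity)
  refine ⟨C ^ |e|, by positivity, fun D x y hx hy hD => ?_⟩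
  have hDp := hD.const_pos hx hy
  have h1 := hD.one_le hx hy
  refine ((H D x y hx hy hD).rpow (h.pos x hx) (h.pos y hy) e).mono
    (Real.rpow_pos_of_pos (h.pos x hx) e) (Real.rpow_pos_of_pos (h.pos y hy) e) ?_
  rw [Real.mul_rpow hC.le (by positivity), ← Real.rpow_mul hDp.le]
  gcongr
  rw [div_mul_eq_mul_div, div_le_iff₀ he]
  nlinarith [abs_nonneg e]

theorem comp (h : Potter b) (h' : Potter b') : Potter (fun t => b (b' t)) := by
  refine ⟨fun t ht => h.pos _ (h'.pos t ht), fun ε hε => ?_⟩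
  obtain ⟨C, hC, H⟩ := h.cmp 1 one_pos
  obtain ⟨C', hC', H'⟩ := h'.cmp ε hε
  refine ⟨C * C', by positivity, fun D x y hx hy hD => ?_⟩
  have := H _ _ _ (h'.pos x hx) (h'.pos y hy) (H' D x y hx hy hD)
  rwa [Real.rpow_one, ← mul_assoc] at this

/-- Uniform comparability at comparable points. -/
theorem cmp_of_cmp (h : Potter b) (D : ℝ) : ∃ C > 0, ∀ x y : ℝ, 0 < x → 0 < y → Cmp D x y →
    Cmp C (b x) (b y) := by
  obtain ⟨C, hC, H⟩ := h.cmp 1 one_pos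
  refine ⟨C * max D 1, by positivity, fun x y hx hy hD => ?_⟩
  have := H (max D 1) x y hx hy (hD.mono hx hy (le_max_left _ _))
  rwa [Real.rpow_one] at this

theorem le_of_le (h : Potter b) {ε : ℝ} (hε : 0 < ε) : ∃ C > 0, ∀ s t : ℝ, 0 < s → s ≤ t →
    b s ≤ C * (t / s) ^ ε * b t ∧ b t ≤ C * (t / s) ^ ε * b s := by
  obtain ⟨C, hC, H⟩ := h.cmp ε hε
  refine ⟨C, hC, fun s t hs hst => H (t / s) s t hs (hs.trans_le hst) ⟨?_, ?_⟩⟩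
  · have h1 : 1 ≤ t / s := (one_le_div hs).2 hst
    nlinarith
  · rw [div_mul_cancel₀ _ hs.ne']

end Potter

/-- That t^ε b is almost increasing bounds b(s) by (t/s)^ε b(t) for s ≤ t; that t^{-ε} b is almost
decreasing gives the reverse bound. In this form the class is visibly closed under products, real
powers and composition. -/
theorem IsSV.potter {b : ℝ → ℝ} (hb : IsSV b) : Potter b := by
  refine Potter.of_le hb.pos fun ε hε => ?_
  obtain ⟨g, hg, hgm, c, hc, C, hC, H⟩ := hb.equiv_mono ε hε
  obtain ⟨g', hg', hgm', c', hc', C', hC', H'⟩ := hb.equiv_anti ε hε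
  refine ⟨max (C / c) (C' / c'), by positivity, fun s t hs hst => ?_⟩
  have ht := hs.trans_le hst
  have hsε : 0 < s ^ ε := by positivity
  have htε : 0 < t ^ ε := by positivity
  have hbs := hb.pos s hs
  have hbt := hb.pos t ht
  have key : ∀ K : ℝ, K ≤ max (C / c) (C' / c') → ∀ x, 0 < x →
      K * (t / s) ^ ε * x ≤ max (C / c) (C' / c') * (t / s) ^ ε * x := by
    intro K hK x hx
    gcongr
  rw [Real.div_rpow ht.le hs.le] at *
  constructor
  · refine le_trans ?_ (key _ (le_max_left _ _) _ hbt)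
    have h1 : s ^ ε * b s ≤ C * g t :=
      (H s hs).2.trans (by gcongr; exact hgm hs ht hst)
    have h2 := (H t ht).1
    rw [div_mul_div_comm, div_mul_eq_mul_div, le_div_iff₀ (by positivity)]
    calc b s * (c * s ^ ε) = c * (s ^ ε * b s) := by ring
      _ ≤ c * (C * g t) := by gcongr
      _ = C * (c * g t) := by ring
      _ ≤ C * (t ^ ε * b t) := by gcongr
      _ = _ := by ring
  · refine le_trans ?_ (key _ (le_max_right _ _) _ hbs)
    have h1 : t ^ (-ε) * b t ≤ C' * g' s :=
      (H' t ht).2.trans (by gcongr; exact hgm' hs ht hst)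
    have h2 := (H' s hs).1
    simp only [Real.rpow_neg hs.le, Real.rpow_neg ht.le] at h1 h2
    have h3 : c' * ((t ^ ε)⁻¹ * b t) ≤ C' * ((s ^ ε)⁻¹ * b s) := by
      calc _ ≤ c' * (C' * g' s) := by gcongr
        _ = C' * (c' * g' s) := by ring
        _ ≤ _ := by gcongr
    have h4 : b t = t ^ ε / c' * (c' * ((t ^ ε)⁻¹ * b t)) := by field_simp
    rw [h4]
    calc _ ≤ t ^ ε / c' * (C' * ((s ^ ε)⁻¹ * b s)) := by gcongr
      _ = _ := by field_simp

/-- A positive almost increasing function is equivalent to an increasing one. -/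
theorem exists_monotoneOn_equivalent {h : ℝ → ℝ} (hpos : ∀ t, 0 < t → 0 < h t) {C : ℝ}
    (hC : 0 < C) (H : ∀ s t, 0 < s → s ≤ t → h s ≤ C * h t) :
    ∃ g : ℝ → ℝ, (∀ t, 0 < t → 0 < g t) ∧ MonotoneOn g (Ioi 0) ∧ Equivalent h g := by
  -- The increasing function is the running supremum of h over (0,t]; almost monotonicity makes it
  -- finite and at most C h(t).
  have hbdd : ∀ t, BddAbove (h '' Ioc 0 t) := by
    rintro t
    refine ⟨C * h t, ?_⟩
    rintro _ ⟨s, hs, rfl⟩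
    exact H s t hs.1 hs.2
  have hle : ∀ t, 0 < t → h t ≤ sSup (h '' Ioc 0 t) := fun t ht =>
    le_csSup (hbdd t) ⟨t, ⟨ht, le_rfl⟩, rfl⟩
  refine ⟨fun t => sSup (h '' Ioc 0 t), fun t ht => (hpos t ht).trans_le (hle t ht), ?_,
    C⁻¹, by positivity, 1, one_pos, fun t ht => ⟨?_, ?_⟩⟩
  · intro s hs t ht hst
    exact csSup_le_csSup (hbdd t) ⟨_, ⟨s, ⟨hs, le_rfl⟩, rfl⟩⟩
      (image_mono (Ioc_subset_Ioc_right hst))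
  · rw [inv_mul_le_iff₀ hC]
    refine csSup_le ⟨_, ⟨t, ⟨ht, le_rfl⟩, rfl⟩⟩ ?_
    rintro _ ⟨s, hs, rfl⟩
    exact H s t hs.1 hs.2
  · simpa using hle t ht

/-- A positive almost decreasing function is equivalent to a decreasing one. -/
theorem exists_antitoneOn_equivalent {h : ℝ → ℝ} (hpos : ∀ t, 0 < t → 0 < h t) {C : ℝ}
    (hC : 0 < C) (H : ∀ s t, 0 < s → s ≤ t → h t ≤ C * h s) :
    ∃ g : ℝ → ℝ, (∀ t, 0 < t → 0 < g t) ∧ AntitoneOn g (Ioi 0) ∧ Equivalent h g := by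
  obtain ⟨g, hg, hgm, c, hc, C', hC', E⟩ := exists_monotoneOn_equivalent (h := fun t => (h t)⁻¹)
    (fun t ht => inv_pos.2 (hpos t ht)) hC (fun s t hs hst => by
      have h1 := hpos s hs
      have h2 := hpos t (hs.trans_le hst)
      rw [← div_eq_mul_inv, inv_eq_one_div, div_le_div_iff₀ h1 h2, one_mul]
      exact H s t hs hst)
  refine ⟨fun t => (g t)⁻¹, fun t ht => inv_pos.2 (hg t ht), fun s hs t ht hst =>
    inv_anti₀ (hg s hs) (hgm hs ht hst), C'⁻¹, by positivity, c⁻¹, by positivity,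
    fun t ht => ⟨?_, ?_⟩⟩
  · rw [← mul_inv, inv_le_comm₀ (mul_pos hC' (hg t ht)) (hpos t ht)]
    exact (E t ht).2
  · rw [← mul_inv, le_inv_comm₀ (hpos t ht) (mul_pos hc (hg t ht))]
    exact (E t ht).1

theorem Potter.isSV {b : ℝ → ℝ} (hb : Potter b)
    (hm : AEMeasurable b (volume.restrict (Ioi 0))) : IsSV b := by
  refine ⟨hb.pos, hm, fun ε hε => ?_, fun ε hε => ?_⟩
  · obtain ⟨C, hC, H⟩ := hb.le_of_le hε
    refine exists_monotoneOn_equivalent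
      (fun t ht => mul_pos (Real.rpow_pos_of_pos ht _) (hb.pos t ht)) hC fun s t hs hst => ?_
    have := (H s t hs hst).1
    have hsp : 0 < s ^ ε := by positivity
    rw [Real.div_rpow (hs.trans_le hst).le hs.le] at this
    calc s ^ ε * b s ≤ s ^ ε * (C * (t ^ ε / s ^ ε) * b t) := by gcongr
      _ = _ := by field_simp
  · obtain ⟨C, hC, H⟩ := hb.le_of_le hε
    refine exists_antitoneOn_equivalent
      (fun t ht => mul_pos (Real.rpow_pos_of_pos ht _) (hb.pos t ht)) hC fun s t hs hst => ?_
    have := (H s t hs hst).2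
    have ht := hs.trans_le hst
    have hsp : 0 < s ^ ε := by positivity
    have htp : 0 < t ^ ε := by positivity
    rw [Real.div_rpow ht.le hs.le] at this
    rw [Real.rpow_neg ht.le, Real.rpow_neg hs.le]
    calc (t ^ ε)⁻¹ * b t ≤ (t ^ ε)⁻¹ * (C * (t ^ ε / s ^ ε) * b s) := by gcongr
      _ = _ := by field_simp

/-! ### Tail integrals of slowly varying functions. -/

/-- Scaling of Lebesgue measure on the line, for arbitrary nonnegative functions. -/
theorem lintegral_comp_const_mul {c : ℝ} (hc : 0 < c) (f : ℝ → ℝ≥0∞) :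
    ∫⁻ u, f u = ENNReal.ofReal c * ∫⁻ v, f (c * v) := by
  have h := lintegral_map_equiv (μ := (volume : Measure ℝ)) f
    (Homeomorph.mulLeft₀ c hc.ne').toMeasurableEquiv
  have h2 := Real.smul_map_volume_mul_left hc.ne'
  rw [abs_of_pos hc] at h2
  have h3 : Measure.map (⇑(Homeomorph.mulLeft₀ c hc.ne').toMeasurableEquiv) volume
      = Measure.map (c * ·) (volume : Measure ℝ) := rfl
  rw [h3] at h
  conv_lhs => rw [← h2]
  rw [lintegral_smul_measure, h, smul_eq_mul]
  rfl

theorem ofReal_weight_rpow {q u x : ℝ} (hq : 0 < q) (hu : 0 < u) (hx : 0 ≤ x) :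
    ENNReal.ofReal (u ^ (-(1 / q)) * x) ^ q = ENNReal.ofReal (x ^ q / u) := by
  rw [ENNReal.ofReal_rpow_of_nonneg (by positivity) hq.le, Real.mul_rpow (by positivity) hx,
    ← Real.rpow_mul hu.le, neg_mul, one_div_mul_cancel hq.ne', Real.rpow_neg_one, mul_comm,
    div_eq_mul_inv]

/-- The tail integral `∫_t^∞ b(u)^q du/u` in `[0, ∞]`. -/
def tailMass (q : ℝ) (b : ℝ → ℝ) (t : ℝ) : ℝ≥0∞ :=
  ∫⁻ u in Ioi t, ENNReal.ofReal (b u ^ q / u)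

section Tail

variable {q : ℝ} {b : ℝ → ℝ}

theorem tailENorm_eq (hq : 0 < q) (hb : ∀ t, 0 < t → 0 < b t) {t : ℝ} (ht : 0 ≤ t) :
    tailENorm q b t = tailMass q b t ^ (1 / q) := by
  unfold tailENorm lqNorm tailMass
  congr 1
  refine setLIntegral_congr_fun measurableSet_Ioi fun u hu => ?_
  have hu' : 0 < u := ht.trans_lt hu
  exact ofReal_weight_rpow hq hu' (hb u hu').le

theorem tailMass_anti {s t : ℝ} (hst : s ≤ t) : tailMass q b t ≤ tailMass q b s :=
  lintegral_mono_set (Ioi_subset_Ioi hst)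

/-- The substitution u = (s/t)v carries (t,∞) onto (s,∞) and preserves du/u, and the Potter bound
compares b at u and at v. This gives both finiteness of the tails down to 0 and slow variation of
the tail norm. -/
theorem tailMass_scale (hq : 0 < q) (hb : Potter b) {ε : ℝ} (hε : 0 < ε) :
    ∃ C > 0, ∀ s t : ℝ, 0 < s → s ≤ t →
      tailMass q b s ≤ ENNReal.ofReal ((C * (t / s) ^ ε) ^ q) * tailMass q b t := by
  obtain ⟨C, hC, H⟩ := hb.le_of_le hε
  refine ⟨C, hC, fun s t hs hst => ?_⟩
  have ht := hs.trans_le hst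
  set c := s / t with hc
  have hcp : 0 < c := by positivity
  unfold tailMass
  rw [← lintegral_indicator measurableSet_Ioi, lintegral_comp_const_mul hcp,
    ← lintegral_const_mul' _ _ ENNReal.ofReal_ne_top, ← lintegral_const_mul' _ _
    ENNReal.ofReal_ne_top, ← lintegral_indicator measurableSet_Ioi]
  refine lintegral_mono fun v => ?_
  have hiff : c * v ∈ Ioi s ↔ v ∈ Ioi t := by
    simp only [mem_Ioi, hc, div_mul_eq_mul_div, lt_div_iff₀ ht]
    exact mul_lt_mul_iff_right₀ hs
  by_cases hv : v ∈ Ioi t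
  · rw [indicator_of_mem (hiff.2 hv), indicator_of_mem hv, ← ENNReal.ofReal_mul hcp.le,
      ← ENNReal.ofReal_mul (by positivity)]
    have hvp : 0 < v := ht.trans hv
    apply ENNReal.ofReal_le_ofReal
    have hle : c * v ≤ v := by
      have : c ≤ 1 := (div_le_one ht).2 hst
      nlinarith
    have h1 := (H (c * v) v (by positivity) hle).1
    have h2 : v / (c * v) = t / s := by rw [hc]; field_simp
    rw [h2] at h1
    have hbcv := hb.pos (c * v) (by positivity)
    have hbv := hb.pos v hvp
    calc c * (b (c * v) ^ q / (c * v)) = b (c * v) ^ q / v := by field_simp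
      _ ≤ (C * (t / s) ^ ε * b v) ^ q / v := by gcongr
      _ = _ := by rw [Real.mul_rpow (by positivity) hbv.le]; ring
  · rw [indicator_of_notMem (fun h => hv (hiff.1 h))]; simp

theorem tailMass_one_lt_top (hq : 0 < q) (hb : IsSV0 q b) : tailMass q b 1 < ∞ := by
  have := hb.tail_lt_top
  rw [tailENorm_eq hq hb.isSV.pos zero_le_one] at this
  exact (ENNReal.rpow_lt_top_iff_of_pos (by positivity)).1 this

theorem tailMass_lt_top (hq : 0 < q) (hb : IsSV0 q b) {t : ℝ} (ht : 0 < t) :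
    tailMass q b t < ∞ := by
  rcases le_total t 1 with h | h
  · obtain ⟨C, hC, H⟩ := tailMass_scale hq hb.isSV.potter one_pos
    exact (H t 1 ht h).trans_lt
      (ENNReal.mul_lt_top ENNReal.ofReal_lt_top (tailMass_one_lt_top hq hb))
  · exact (tailMass_anti h).trans_lt (tailMass_one_lt_top hq hb)

/-- On (t,2t] alone b is comparable to b(t), and du/u gives this interval a mass bounded below. -/
theorem le_tailMass (hq : 0 < q) (hb : Potter b) :
    ∃ c > 0, ∀ t : ℝ, 0 < t → ENNReal.ofReal (c * b t ^ q) ≤ tailMass q b t := by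
  obtain ⟨C, hC, H⟩ := hb.cmp_of_cmp 2
  refine ⟨(C ^ q)⁻¹ / 2, by positivity, fun t ht => ?_⟩
  have hbt := hb.pos t ht
  calc ENNReal.ofReal ((C ^ q)⁻¹ / 2 * b t ^ q)
      = ∫⁻ _ in Ioc t (2 * t), ENNReal.ofReal ((C ^ q)⁻¹ * b t ^ q / (2 * t)) := by
        rw [setLIntegral_const, Real.volume_Ioc, ← ENNReal.ofReal_mul (by positivity)]
        congr 1
        field_simp
        ring
    _ ≤ ∫⁻ u in Ioc t (2 * t), ENNReal.ofReal (b u ^ q / u) := by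
        refine setLIntegral_mono' measurableSet_Ioc fun u hu => ENNReal.ofReal_le_ofReal ?_
        have hu0 : 0 < u := ht.trans hu.1
        have hbu := hb.pos u hu0
        have h1 := (H t u ht hu0 ⟨by linarith [hu.1], hu.2⟩).1
        have h2 : b t ^ q ≤ C ^ q * b u ^ q := by
          rw [← Real.mul_rpow hC.le hbu.le]
          gcongr
        have h3 : (C ^ q)⁻¹ * b t ^ q ≤ b u ^ q := by
          rw [inv_mul_le_iff₀ (by positivity)]; exact h2
        have := hu.2
        gcongr
    _ ≤ _ := lintegral_mono_set Ioc_subset_Ioi_self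

theorem tailMass_toReal_pos (hq : 0 < q) (hb : IsSV0 q b) {t : ℝ} (ht : 0 < t) :
    0 < (tailMass q b t).toReal := by
  obtain ⟨c, hc, H⟩ := le_tailMass hq hb.isSV.potter
  refine ENNReal.toReal_pos ?_ (tailMass_lt_top hq hb ht).ne
  have := hb.isSV.pos t ht
  exact ((ENNReal.ofReal_pos.2 (by positivity)).trans_le (H t ht)).ne'

theorem tailNorm_eq (hq : 0 < q) (hb : IsSV0 q b) {t : ℝ} (ht : 0 < t) :
    tailNorm q b t = (tailMass q b t).toReal ^ (1 / q) := by
  rw [tailNorm, tailENorm_eq hq hb.isSV.pos ht.le, ENNReal.toReal_rpow]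

theorem tailNorm_pos (hq : 0 < q) (hb : IsSV0 q b) {t : ℝ} (ht : 0 < t) : 0 < tailNorm q b t := by
  rw [tailNorm_eq hq hb ht]
  exact Real.rpow_pos_of_pos (tailMass_toReal_pos hq hb ht) _

theorem tailNorm_rpow (hq : 0 < q) (hb : IsSV0 q b) {t : ℝ} (ht : 0 < t) :
    tailNorm q b t ^ q = (tailMass q b t).toReal := by
  rw [tailNorm_eq hq hb ht, ← Real.rpow_mul ENNReal.toReal_nonneg, one_div_mul_cancel hq.ne',
    Real.rpow_one]

theorem ofReal_tailNorm_rpow (hq : 0 < q) (hb : IsSV0 q b) {t : ℝ} (ht : 0 < t) :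
    ENNReal.ofReal (tailNorm q b t ^ q) = tailMass q b t := by
  rw [tailNorm_rpow hq hb ht, ENNReal.ofReal_toReal (tailMass_lt_top hq hb ht).ne]

theorem tailNorm_anti (hq : 0 < q) (hb : IsSV0 q b) {s t : ℝ} (hs : 0 < s) (hst : s ≤ t) :
    tailNorm q b t ≤ tailNorm q b s := by
  have ht := hs.trans_le hst
  rw [tailNorm_eq hq hb hs, tailNorm_eq hq hb ht]
  have := ENNReal.toReal_mono (tailMass_lt_top hq hb hs).ne (tailMass_anti (q := q) (b := b) hst)
  gcongr

theorem le_tailNorm (hq : 0 < q) (hb : IsSV0 q b) :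
    ∃ C > 0, ∀ t : ℝ, 0 < t → b t ^ q ≤ C * tailNorm q b t ^ q := by
  obtain ⟨c, hc, H⟩ := le_tailMass hq hb.isSV.potter
  refine ⟨c⁻¹, by positivity, fun t ht => ?_⟩
  rw [tailNorm_rpow hq hb ht, ← div_eq_inv_mul, le_div_iff₀ hc, mul_comm]
  exact (ENNReal.ofReal_le_iff_le_toReal (tailMass_lt_top hq hb ht).ne).1 (H t ht)

theorem potter_tailNorm (hq : 0 < q) (hb : IsSV0 q b) : Potter (tailNorm q b) := by
  refine Potter.of_le (fun t ht => tailNorm_pos hq hb ht) fun ε hε => ?_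
  obtain ⟨C, hC, H⟩ := tailMass_scale hq hb.isSV.potter hε
  refine ⟨max C 1, by positivity, fun s t hs hst => ?_⟩
  have ht := hs.trans_le hst
  have hat := tailNorm_pos hq hb ht
  have has := tailNorm_pos hq hb hs
  have h1 : 1 ≤ (t / s) ^ ε := Real.one_le_rpow ((one_le_div hs).2 hst) hε.le
  constructor
  · have h2 : tailNorm q b s ^ q ≤ (C * (t / s) ^ ε * tailNorm q b t) ^ q := by
      rw [Real.mul_rpow (by positivity) hat.le]
      refine (ENNReal.ofReal_le_ofReal_iff (by positivity)).1 ?_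
      rw [ENNReal.ofReal_mul (by positivity), ofReal_tailNorm_rpow hq hb ht,
        ofReal_tailNorm_rpow hq hb hs]
      exact H s t hs hst
    have h3 := (Real.rpow_le_rpow_iff has.le (by positivity) hq).1 h2
    refine h3.trans ?_
    gcongr
    exact le_max_left _ _
  · refine (tailNorm_anti hq hb hs hst).trans ?_
    have : 1 ≤ max C 1 * (t / s) ^ ε := one_le_mul_of_one_le_of_one_le (le_max_right _ _) h1
    exact le_mul_of_one_le_left has.le this

theorem aemeasurable_rpow_div (hb : IsSV b) {t : ℝ} (ht : 0 ≤ t) :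
    AEMeasurable (fun u => b u ^ q / u) (volume.restrict (Ioi t)) :=
  ((hb.aemeasurable.mono_measure (Measure.restrict_mono (Ioi_subset_Ioi ht) le_rfl)).pow_const
    q).div aemeasurable_id

theorem integrableOn_tail (hq : 0 < q) (hb : IsSV0 q b) {t : ℝ} (ht : 0 < t) :
    IntegrableOn (fun u => b u ^ q / u) (Ioi t) := by
  refine ⟨(aemeasurable_rpow_div hb.isSV ht.le).aestronglyMeasurable, ?_⟩
  rw [hasFiniteIntegral_iff_ofReal]
  · exact tailMass_lt_top hq hb ht
  · filter_upwards [ae_restrict_mem measurableSet_Ioi] with u hu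
    have hu' : 0 < u := ht.trans hu
    have := hb.isSV.pos u hu'
    positivity

theorem integral_tail_eq (hq : 0 < q) (hb : IsSV0 q b) {t : ℝ} (ht : 0 < t) :
    ∫ u in Ioi t, b u ^ q / u = tailNorm q b t ^ q := by
  rw [tailNorm_rpow hq hb ht, integral_eq_lintegral_of_nonneg_ae, tailMass]
  · filter_upwards [ae_restrict_mem measurableSet_Ioi] with u hu
    have hu' : 0 < u := ht.trans hu
    have := hb.isSV.pos u hu'
    simp only [Pi.zero_apply]
    positivity
  · exact (aemeasurable_rpow_div hb.isSV ht.le).aestronglyMeasurable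

/-- The q-th power of the tail norm is a continuous tail integral tending to 0 at infinity, so the
intermediate value theorem applies once it is unbounded. This places the grid points at prescribed
values. -/
theorem exists_tailNorm_eq (hq : 0 < q) (hb : IsSV0 q b)
    (hunb : ∀ K : ℝ, ∃ t > 0, K ≤ tailNorm q b t) {y : ℝ} (hy : 0 < y) :
    ∃ t > 0, tailNorm q b t = y := by
  obtain ⟨s, hs, hsy⟩ := hunb y
  have hlim : Filter.Tendsto (fun x => ∫ u in Ioi x, b u ^ q / u) Filter.atTop (nhds 0) :=
    tendsto_integral_Ioi_zero Filter.tendsto_id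
  obtain ⟨t, htlt, hst⟩ := ((hlim.eventually (gt_mem_nhds (Real.rpow_pos_of_pos hy q))).and
    (Filter.eventually_ge_atTop s)).exists
  have ht := hs.trans_le hst
  have hcont : ContinuousOn (fun x => ∫ u in Ioi x, b u ^ q / u) (Icc s t) :=
    (integrableOn_tail hq hb hs).continuousOn_Ici_primitive_Ioi.mono Icc_subset_Ici_self
  have hmem : y ^ q ∈ Icc (∫ u in Ioi t, b u ^ q / u) (∫ u in Ioi s, b u ^ q / u) := by
    refine ⟨htlt.le, ?_⟩
    rw [integral_tail_eq hq hb hs]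
    gcongr
  obtain ⟨x, hx, hxy⟩ := intermediate_value_Icc' hst hcont hmem
  have hx0 : 0 < x := hs.trans_le hx.1
  refine ⟨x, hx0, ?_⟩
  simp only [integral_tail_eq hq hb hx0] at hxy
  exact (Real.rpow_left_inj (tailNorm_pos hq hb hx0).le hy.le hq.ne').1 hxy

end Tail

/-- Bounding x + y by twice the larger term treats exponents below and above 1 alike. -/
theorem rpow_add_le_two_rpow_mul {e : ℝ} (he : 0 ≤ e) (x y : ℝ≥0∞) :
    (x + y) ^ e ≤ 2 ^ e * (x ^ e + y ^ e) := by
  wlog h : x ≤ y generalizing x y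
  · rw [add_comm x, add_comm (x ^ e)]
    exact this y x (le_of_not_ge h)
  calc (x + y) ^ e ≤ (2 * y) ^ e := by rw [two_mul]; gcongr
    _ = 2 ^ e * y ^ e := ENNReal.mul_rpow_of_nonneg _ _ he
    _ ≤ _ := by gcongr; exact le_add_self

/-! ### Non-increasing rearrangements and truncation. -/

section Rearrangement

variable {Ω : Type*} [MeasurableSpace Ω] {μ : Measure Ω}

theorem rearrangement_antitone (f : Ω →ₘ[μ] ℝ) : Antitone (rearrangement f) := fun _ _ hst =>
  sInf_le_sInf fun _ hl => le_trans hl (ENNReal.ofReal_le_ofReal hst)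

theorem rearrangement_mono {f g : Ω →ₘ[μ] ℝ} (h : ∀ᵐ x ∂μ, ‖f x‖ₑ ≤ ‖g x‖ₑ) (t : ℝ) :
    rearrangement f t ≤ rearrangement g t := by
  refine sInf_le_sInf fun l hl => le_trans (measure_mono_ae ?_) hl
  filter_upwards [h] with x hx hl
  exact lt_of_lt_of_le hl hx

theorem rearrangement_le_of_ae_le {f : Ω →ₘ[μ] ℝ} {c : ℝ≥0∞} (h : ∀ᵐ x ∂μ, ‖f x‖ₑ ≤ c) (t : ℝ) :
    rearrangement f t ≤ c := by
  refine sInf_le ?_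
  have : μ {x | c < ‖f x‖ₑ} = 0 := by
    rw [measure_eq_zero_iff_ae_notMem]
    filter_upwards [h] with x hx
    simpa using hx
  simp [this]

theorem rearrangement_add_le (g h : Ω →ₘ[μ] ℝ) {s t : ℝ} (hs : 0 ≤ s) (ht : 0 ≤ t) :
    rearrangement (g + h) (s + t) ≤ rearrangement g s + rearrangement h t := by
  unfold rearrangement
  rw [ENNReal.sInf_add]
  refine le_iInf₂ fun l hl => ?_
  rw [add_comm l, ENNReal.sInf_add]
  refine le_iInf₂ fun l' hl' => ?_
  refine sInf_le ?_
  calc μ {x | l' + l < ‖(g + h) x‖ₑ} ≤ μ ({x | l < ‖g x‖ₑ} ∪ {x | l' < ‖h x‖ₑ}) := by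
        refine measure_mono_ae ?_
        filter_upwards [AEEqFun.coeFn_add g h] with x hx hlt
        have hlt' : l' + l < ‖(g + h) x‖ₑ := hlt
        rw [hx] at hlt'
        by_contra hnot
        have hnot' : ¬ (l < ‖g x‖ₑ ∨ l' < ‖h x‖ₑ) := hnot
        push Not at hnot'
        have := (enorm_add_le (g x) (h x)).trans (add_le_add hnot'.1 hnot'.2)
        rw [add_comm l] at this
        exact absurd hlt' (not_lt.2 this)
    _ ≤ _ := measure_union_le _ _
    _ ≤ ENNReal.ofReal s + ENNReal.ofReal t := add_le_add hl hl'
    _ = _ := (ENNReal.ofReal_add hs ht).symm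

/-- The infimum defining f^*(t) is attained: the set {|f| > f^*(t)} is an increasing union of level
sets at heights decreasing to f^*(t), so continuity of μ from below applies. -/
theorem measure_rearrangement_lt_le (f : Ω →ₘ[μ] ℝ) (t : ℝ) :
    μ {x | rearrangement f t < ‖f x‖ₑ} ≤ ENNReal.ofReal t := by
  set a := rearrangement f t
  by_cases ha : a = ∞
  · have : {x | a < ‖f x‖ₑ} = ∅ := by ext; simp [ha]
    rw [this]; simp
  obtain ⟨u, hu, hua, hlim⟩ := exists_seq_strictAnti_tendsto' (lt_top_iff_ne_top.2 ha)
  have hset : {x | a < ‖f x‖ₑ} = ⋃ n, {x | u n < ‖f x‖ₑ} := by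
    ext x
    simp only [mem_ofPred_eq, mem_iUnion]
    constructor
    · intro hx
      exact (hlim.eventually (gt_mem_nhds hx)).exists
    · rintro ⟨n, hn⟩
      exact (hua n).1.trans hn
  have hmono : Monotone fun n => {x | u n < ‖f x‖ₑ} := fun m n hmn x hx =>
    lt_of_le_of_lt (hu.antitone hmn) hx
  rw [hset, hmono.measure_iUnion]
  refine iSup_le fun n => ?_
  obtain ⟨l, hl, hln⟩ := sInf_lt_iff.1 (show sInf _ < u n from (hua n).1)
  exact (measure_mono fun x hx => lt_trans hln hx).trans hl

/-- Truncation of `f` at the height `f^*(t)`. -/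
theorem exists_truncation (f : Ω →ₘ[μ] ℝ) {t : ℝ} (hf : rearrangement f t ≠ ∞) :
    ∃ f₀ f₁ : Ω →ₘ[μ] ℝ, f = f₀ + f₁ ∧
      (∀ τ, rearrangement f₀ τ ≤ rearrangement f τ) ∧
      (∀ τ, rearrangement f₁ τ ≤ rearrangement f τ) ∧
      (∀ τ, t ≤ τ → rearrangement f₀ τ = 0) ∧
      (∀ τ, rearrangement f₁ τ ≤ rearrangement f t) := by
  set c : ℝ := (rearrangement f t).toReal with hc
  have hc0 : 0 ≤ c := ENNReal.toReal_nonneg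
  have hcE : ENNReal.ofReal c = rearrangement f t := ENNReal.ofReal_toReal hf
  -- The bounded part of f is its clamp to [-c,c], with c = f^*(t); the remainder vanishes wherever
  -- |f| ≤ c.
  have hcont : Continuous fun x : ℝ => max (-c) (min c x) := by fun_prop
  set f₁ : Ω →ₘ[μ] ℝ := f.comp _ hcont with hf₁
  have h1 : ∀ᵐ x ∂μ, f₁ x = max (-c) (min c (f x)) := AEEqFun.coeFn_comp _ hcont f
  have h0 : ∀ᵐ x ∂μ, (f - f₁) x = f x - max (-c) (min c (f x)) := by
    filter_upwards [h1, AEEqFun.coeFn_sub f f₁] with x hx hx'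
    rw [hx', Pi.sub_apply, hx]
  have key : ∀ y : ℝ, |max (-c) (min c y)| ≤ |y| ∧ |y - max (-c) (min c y)| ≤ |y| ∧
      |max (-c) (min c y)| ≤ c ∧ (|y| ≤ c → y - max (-c) (min c y) = 0) := by
    intro y
    rcases le_total c y with h | h
    · rw [min_eq_left h, max_eq_right (by linarith), abs_of_nonneg hc0,
        abs_of_nonneg (hc0.trans h), abs_of_nonneg (by linarith)]
      exact ⟨h, by linarith, le_rfl, fun h' => by linarith⟩
    · rw [min_eq_right h]
      rcases le_total (-c) y with h' | h'
      · rw [max_eq_right h', sub_self]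
        exact ⟨le_rfl, by simp, abs_le.2 ⟨h', h⟩, fun _ => rfl⟩
      · rw [max_eq_left h', abs_neg, abs_of_nonneg hc0, abs_of_nonpos (by linarith),
          abs_of_nonpos (by linarith)]
        exact ⟨by linarith, by linarith, le_rfl, fun h' => by linarith⟩
  have hen : ∀ x y : ℝ, |x| ≤ |y| → ‖x‖ₑ ≤ ‖y‖ₑ := fun x y h => by
    rw [← ofReal_norm, ← ofReal_norm]
    exact ENNReal.ofReal_le_ofReal h
  refine ⟨f - f₁, f₁, (sub_add_cancel f f₁).symm, fun τ => rearrangement_mono ?_ τ,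
    fun τ => rearrangement_mono ?_ τ, fun τ hτ => ?_,
    fun τ => rearrangement_le_of_ae_le ?_ τ⟩
  · filter_upwards [h0] with x hx
    rw [hx]; exact hen _ _ (key _).2.1
  · filter_upwards [h1] with x hx
    rw [hx]; exact hen _ _ (key _).1
  -- The support of the remainder lies in {|f| > f^*(t)}, of measure at most t, so height 0 is
  -- already admissible at every τ ≥ t.
  · refine le_antisymm (sInf_le ?_) zero_le
    refine le_trans (measure_mono_ae ?_) ((measure_rearrangement_lt_le f t).trans
      (ENNReal.ofReal_le_ofReal hτ))
    filter_upwards [h0] with x hx hlt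
    have hlt' : 0 < ‖(f - f₁) x‖ₑ := hlt
    rw [hx] at hlt'
    change rearrangement f t < ‖f x‖ₑ
    rw [← hcE, ← ofReal_norm]
    have : c < |f x| := by
      by_contra! hle
      rw [(key _).2.2.2 hle] at hlt'
      simp at hlt'
    exact (ENNReal.ofReal_lt_ofReal_iff (hc0.trans_lt this)).2 this
  · filter_upwards [h1] with x hx
    rw [hx, ← hcE, ← ofReal_norm]
    exact ENNReal.ofReal_le_ofReal (key _).2.2.1

end Rearrangement

/-! ### Integrals of powers times slowly varying functions. -/

section PowerWeights

variable {v : ℝ → ℝ} {α : ℝ}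

/-- Half of the exponent absorbs v: v(u) ≤ C(t/u)^{α/2} v(t), and the remaining u^{α/2-1} is
integrable at 0. -/
theorem lintegral_rpow_mul_le (hv : Potter v) (hα : 0 < α) :
    ∃ C > 0, ∀ t : ℝ, 0 < t →
      ∫⁻ u in Ioo 0 t, ENNReal.ofReal (u ^ (α - 1) * v u) ≤ ENNReal.ofReal (C * (t ^ α * v t)) := by
  obtain ⟨C, hC, H⟩ := hv.le_of_le (half_pos hα)
  refine ⟨C / (α / 2), by positivity, fun t ht => ?_⟩
  have hvt := hv.pos t ht
  have hint : IntervalIntegrable (fun u : ℝ => u ^ (α / 2 - 1)) volume 0 t :=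
    intervalIntegral.intervalIntegrable_rpow' (by linarith)
  have hpow : ∫⁻ u in Ioo 0 t, ENNReal.ofReal (u ^ (α / 2 - 1))
      = ENNReal.ofReal (t ^ (α / 2) / (α / 2)) := by
    rw [← ofReal_integral_eq_lintegral_ofReal, ← integral_Ioc_eq_integral_Ioo,
      ← intervalIntegral.integral_of_le ht.le, integral_rpow (Or.inl (by linarith))]
    · rw [sub_add_cancel, Real.zero_rpow (by positivity), sub_zero]
    · exact ((intervalIntegrable_iff_integrableOn_Ioc_of_le ht.le).1 hint).mono_set
        Ioo_subset_Ioc_self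
    · filter_upwards [ae_restrict_mem measurableSet_Ioo] with u hu
      exact Real.rpow_nonneg hu.1.le _
  calc ∫⁻ u in Ioo 0 t, ENNReal.ofReal (u ^ (α - 1) * v u)
      ≤ ∫⁻ u in Ioo 0 t, ENNReal.ofReal (C * t ^ (α / 2) * v t) *
          ENNReal.ofReal (u ^ (α / 2 - 1)) := by
        refine setLIntegral_mono' measurableSet_Ioo fun u hu => ?_
        have hu0 := hu.1
        rw [← ENNReal.ofReal_mul (by positivity)]
        refine ENNReal.ofReal_le_ofReal ?_
        have h1 := (H u t hu.1 hu.2.le).1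
        calc u ^ (α - 1) * v u ≤ u ^ (α - 1) * (C * (t / u) ^ (α / 2) * v t) := by gcongr
          _ = _ := by
            have : u ^ (α - 1) = u ^ (α / 2 - 1) * u ^ (α / 2) := by
              rw [← Real.rpow_add hu0]; ring_nf
            have hp : 0 < u ^ (α / 2) := by positivity
            rw [Real.div_rpow ht.le hu0.le, this]
            field_simp
    _ = _ := by
        rw [lintegral_const_mul' _ _ ENNReal.ofReal_ne_top, hpow,
          ← ENNReal.ofReal_mul (by positivity)]
        congr 1
        have : t ^ α = t ^ (α / 2) * t ^ (α / 2) := by rw [← Real.rpow_add ht]; ring_nf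
        rw [this]
        ring

/-- Only the piece (t/2,t) is kept, where the integrand is comparable to its value at t; hence no
sign of α is needed. -/
theorem le_lintegral_rpow_mul (hv : Potter v) (α : ℝ) :
    ∃ c > 0, ∀ t : ℝ, 0 < t →
      ENNReal.ofReal (c * (t ^ α * v t)) ≤ ∫⁻ u in Ioo 0 t, ENNReal.ofReal (u ^ (α - 1) * v u) := by
  obtain ⟨C, hC, H⟩ := hv.cmp_of_cmp 2
  refine ⟨(2 ^ |α - 1| * C)⁻¹ / 2, by positivity, fun t ht => ?_⟩
  have hvt := hv.pos t ht
  calc ENNReal.ofReal ((2 ^ |α - 1| * C)⁻¹ / 2 * (t ^ α * v t))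
      = ∫⁻ _ in Ioo (t / 2) t, ENNReal.ofReal ((2 ^ |α - 1| * C)⁻¹ * (t ^ (α - 1) * v t)) := by
        rw [setLIntegral_const, Real.volume_Ioo, ← ENNReal.ofReal_mul (by positivity)]
        congr 1
        rw [Real.rpow_sub_one ht.ne']
        field_simp
        ring
    _ ≤ ∫⁻ u in Ioo (t / 2) t, ENNReal.ofReal (u ^ (α - 1) * v u) := by
        refine setLIntegral_mono' measurableSet_Ioo fun u hu => ENNReal.ofReal_le_ofReal ?_
        have hu0 : 0 < u := (half_pos ht).trans hu.1
        have hvu := hv.pos u hu0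
        have hcmp : Cmp 2 t u := ⟨by linarith [hu.1], by linarith [hu.2]⟩
        rw [inv_mul_le_iff₀ (by positivity)]
        exact ((hcmp.rpow ht hu0 (α - 1)).mul (by positivity) (by positivity) hvt hvu
          (H t u ht hu0 hcmp)).1
    _ ≤ _ := lintegral_mono_set (Ioo_subset_Ioo_left (half_pos ht).le)

end PowerWeights

/-! ### The inner quasi-norm. -/

/-- The inner quasi-norm `‖τ^{1/p-1/r} w(τ) f^*(τ)‖_{r,(0,t)}` of the gamma space. -/
def innerNorm {Ω : Type*} [MeasurableSpace Ω] {μ : Measure Ω} (r p : ℝ) (w : ℝ → ℝ)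
    (f : Ω →ₘ[μ] ℝ) (t : ℝ) : ℝ≥0∞ :=
  lqNorm r (Ioo 0 t) (fun τ => ENNReal.ofReal (τ ^ (1 / p - 1 / r) * w τ) * rearrangement f τ)

section InnerNorm

variable {Ω : Type*} [MeasurableSpace Ω] {μ : Measure Ω} {r p : ℝ} {w : ℝ → ℝ}

theorem innerNorm_eq (hr : 0 < r) (hw : ∀ t, 0 < t → 0 < w t) (f : Ω →ₘ[μ] ℝ) (t : ℝ) :
    innerNorm r p w f t = (∫⁻ τ in Ioo 0 t, ENNReal.ofReal (τ ^ (r / p - 1) * w τ ^ r) *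
      rearrangement f τ ^ r) ^ (1 / r) := by
  unfold innerNorm lqNorm
  congr 1
  refine setLIntegral_congr_fun measurableSet_Ioo fun τ hτ => ?_
  have hτ0 := hτ.1
  have hwτ := hw τ hτ0
  simp only
  rw [ENNReal.mul_rpow_of_nonneg _ _ hr.le, ENNReal.ofReal_rpow_of_nonneg (by positivity) hr.le,
    Real.mul_rpow (by positivity) hwτ.le, ← Real.rpow_mul hτ0.le]
  congr 4
  field_simp

theorem innerNorm_monotone (hr : 0 < r) (f : Ω →ₘ[μ] ℝ) : Monotone (innerNorm r p w f) :=
  fun _ _ hst => ENNReal.rpow_le_rpow (lintegral_mono_set (Ioo_subset_Ioo_right hst))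
    (by positivity)

theorem innerNorm_mono (hr : 0 < r) {f g : Ω →ₘ[μ] ℝ}
    (h : ∀ τ, rearrangement f τ ≤ rearrangement g τ) (t : ℝ) :
    innerNorm r p w f t ≤ innerNorm r p w g t := by
  unfold innerNorm lqNorm
  refine ENNReal.rpow_le_rpow (lintegral_mono fun τ => ?_) (by positivity)
  exact ENNReal.rpow_le_rpow (mul_le_mul_right (h τ) _) hr.le

/-- The inner norm stops growing where the rearrangement has died out. -/
theorem innerNorm_le_of_vanish (hr : 0 < r) {f : Ω →ₘ[μ] ℝ} {t : ℝ}
    (h : ∀ τ, t ≤ τ → rearrangement f τ = 0) (u : ℝ) :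
    innerNorm r p w f u ≤ innerNorm r p w f t := by
  unfold innerNorm lqNorm
  refine ENNReal.rpow_le_rpow ?_ (by positivity)
  rw [← lintegral_indicator measurableSet_Ioo, ← lintegral_indicator measurableSet_Ioo]
  refine lintegral_mono fun τ => ?_
  by_cases hτ : τ ∈ Ioo 0 u
  · by_cases hτt : τ < t
    · rw [indicator_of_mem hτ, indicator_of_mem (show τ ∈ Ioo 0 t from ⟨hτ.1, hτt⟩)]
    · simp only [indicator_of_mem hτ]
      rw [h τ (not_lt.1 hτt), mul_zero, ENNReal.zero_rpow_of_pos hr]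
      exact zero_le
  · rw [indicator_of_notMem hτ]
    exact zero_le

theorem innerNorm_le_of_bounded (hr : 0 < r) (hp : 0 < p) (hw : Potter w) :
    ∃ C > 0, ∀ (f : Ω →ₘ[μ] ℝ) (a : ℝ≥0∞), (∀ τ, rearrangement f τ ≤ a) → ∀ t, 0 < t →
      innerNorm r p w f t ≤ ENNReal.ofReal (C * (t ^ (1 / p) * w t)) * a := by
  obtain ⟨C, hC, H⟩ := lintegral_rpow_mul_le (hw.rpow r) (div_pos hr hp)
  refine ⟨C ^ (1 / r), by positivity, fun f a ha t ht => ?_⟩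
  have hwt := hw.pos t ht
  rw [innerNorm_eq hr hw.pos]
  calc _ ≤ (∫⁻ τ in Ioo 0 t, ENNReal.ofReal (τ ^ (r / p - 1) * w τ ^ r) * a ^ r) ^ (1 / r) := by
        gcongr with τ
        exact ha τ
    _ ≤ (ENNReal.ofReal (C * (t ^ (r / p) * w t ^ r)) * a ^ r) ^ (1 / r) := by
        refine ENNReal.rpow_le_rpow ?_ (by positivity)
        -- Without measurability only a finite constant may leave the integral; if it is infinite,
        -- so is the right-hand side.
        by_cases hat : a ^ r = ∞
        · rw [hat, ENNReal.mul_top (ENNReal.ofReal_pos.2 (by positivity)).ne']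
          exact le_top
        · rw [lintegral_mul_const' _ _ hat]
          gcongr
          exact H t ht
    _ = _ := by
        rw [ENNReal.mul_rpow_of_nonneg _ _ (by positivity), ← ENNReal.rpow_mul,
          mul_one_div_cancel hr.ne', ENNReal.rpow_one,
          ENNReal.ofReal_rpow_of_nonneg (by positivity) (by positivity),
          Real.mul_rpow hC.le (by positivity), Real.mul_rpow (by positivity) (by positivity),
          ← Real.rpow_mul ht.le, ← Real.rpow_mul hwt.le, mul_one_div_cancel hr.ne', Real.rpow_one]
        congr 5
        field_simp

/-- On (0,t) the rearrangement is at least its value at t, and the weight that remains integrates to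
about t^{r/p} w(t)^r. -/
theorem rearrangement_le_innerNorm (hr : 0 < r) (hw : Potter w) :
    ∃ c > 0, ∀ (f : Ω →ₘ[μ] ℝ) (t : ℝ), 0 < t →
      ENNReal.ofReal (c * (t ^ (1 / p) * w t)) * rearrangement f t ≤ innerNorm r p w f t := by
  obtain ⟨c, hc, H⟩ := le_lintegral_rpow_mul (hw.rpow r) (r / p)
  refine ⟨c ^ (1 / r), by positivity, fun f t ht => ?_⟩
  have hwt := hw.pos t ht
  rw [innerNorm_eq hr hw.pos]
  calc ENNReal.ofReal (c ^ (1 / r) * (t ^ (1 / p) * w t)) * rearrangement f t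
      = (ENNReal.ofReal (c * (t ^ (r / p) * w t ^ r)) * rearrangement f t ^ r) ^ (1 / r) := by
        rw [ENNReal.mul_rpow_of_nonneg _ _ (by positivity), ← ENNReal.rpow_mul,
          mul_one_div_cancel hr.ne', ENNReal.rpow_one,
          ENNReal.ofReal_rpow_of_nonneg (by positivity) (by positivity),
          Real.mul_rpow hc.le (by positivity), Real.mul_rpow (by positivity) (by positivity),
          ← Real.rpow_mul ht.le, ← Real.rpow_mul hwt.le, mul_one_div_cancel hr.ne', Real.rpow_one]
        congr 5
        field_simp
    _ ≤ ((∫⁻ τ in Ioo 0 t, ENNReal.ofReal (τ ^ (r / p - 1) * w τ ^ r)) *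
          rearrangement f t ^ r) ^ (1 / r) := by
        gcongr
        exact H t ht
    _ ≤ (∫⁻ τ in Ioo 0 t, ENNReal.ofReal (τ ^ (r / p - 1) * w τ ^ r) *
          rearrangement f t ^ r) ^ (1 / r) := by
        gcongr
        exact lintegral_mul_const_le _ _
    _ ≤ _ := by
        refine ENNReal.rpow_le_rpow ?_ (by positivity)
        refine setLIntegral_mono' measurableSet_Ioo fun τ hτ => ?_
        gcongr
        exact rearrangement_antitone f hτ.2.le

/-- From (g+h)^*(τ) ≤ g^*(τ/2) + h^*(τ/2) the substitution τ = 2σ leads back to the original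
integrals, since w(2σ) is comparable to w(σ). Measurability of w is needed to split the integral of
a sum. -/
theorem innerNorm_add_le (hr : 0 < r) (hw : IsSV w) :
    ∃ C > 0, ∀ (g h : Ω →ₘ[μ] ℝ) (t : ℝ),
      innerNorm r p w (g + h) t ≤
        ENNReal.ofReal C * (innerNorm r p w g t + innerNorm r p w h t) := by
  obtain ⟨C, hC, H⟩ := (hw.potter.rpow r).cmp_of_cmp 2
  set α := r / p with hα
  set k : ℝ → ℝ≥0∞ := fun τ => ENNReal.ofReal (τ ^ (α - 1) * w τ ^ r) with hk
  -- The Jacobian of τ = 2σ, the power weight and the comparison of w^r contribute one factor each.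
  set K : ℝ := 2 * (2 ^ (α - 1) * C) with hK
  have hKpos : 0 < K := by positivity
  have hscale : ∀ (g : Ω →ₘ[μ] ℝ) (t : ℝ), ∫⁻ τ in Ioo 0 t, k τ * rearrangement g (τ / 2) ^ r
      ≤ ENNReal.ofReal K * ∫⁻ τ in Ioo 0 t, k τ * rearrangement g τ ^ r := by
    intro g t
    rw [← lintegral_indicator measurableSet_Ioo, lintegral_comp_const_mul two_pos,
      ← lintegral_const_mul' _ _ ENNReal.ofReal_ne_top, ← lintegral_const_mul' _ _
      ENNReal.ofReal_ne_top, ← lintegral_indicator measurableSet_Ioo]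
    refine lintegral_mono fun σ => ?_
    by_cases hσ : 2 * σ ∈ Ioo 0 t
    · have hσ0 : 0 < σ := by linarith [hσ.1]
      have hσt : σ ∈ Ioo 0 t := ⟨hσ0, by linarith [hσ.2]⟩
      rw [indicator_of_mem hσ, indicator_of_mem hσt, mul_div_cancel_left₀ _ two_ne_zero,
        ← mul_assoc, ← mul_assoc]
      refine mul_le_mul_left ?_ _
      simp only [hk]
      have hw2 := hw.pos (2 * σ) (by positivity)
      have hw1 := hw.pos σ hσ0
      rw [← ENNReal.ofReal_mul two_pos.le, ← ENNReal.ofReal_mul hKpos.le]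
      refine ENNReal.ofReal_le_ofReal ?_
      have h1 := (H (2 * σ) σ (by positivity) hσ0 ⟨le_rfl, by linarith⟩).1
      rw [Real.mul_rpow two_pos.le hσ0.le]
      calc 2 * (2 ^ (α - 1) * σ ^ (α - 1) * w (2 * σ) ^ r)
          ≤ 2 * (2 ^ (α - 1) * σ ^ (α - 1) * (C * w σ ^ r)) := by gcongr
        _ = _ := by rw [hK]; ring
    · rw [indicator_of_notMem hσ]; simp
  refine ⟨2 * K ^ (1 / r) * 2 ^ (1 / r), by positivity, fun g h t => ?_⟩
  rw [innerNorm_eq hr hw.pos, innerNorm_eq hr hw.pos, innerNorm_eq hr hw.pos]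
  set G := ∫⁻ τ in Ioo 0 t, k τ * rearrangement g τ ^ r with hG
  set G' := ∫⁻ τ in Ioo 0 t, k τ * rearrangement h τ ^ r with hG'
  have hkm : AEMeasurable k (volume.restrict (Ioo 0 t)) := by
    have := hw.aemeasurable.mono_measure
      (Measure.restrict_mono (fun x (hx : x ∈ Ioo 0 t) => hx.1) le_rfl)
    exact ((aemeasurable_id.pow_const _).mul (this.pow_const r)).ennreal_ofReal
  have hgm : Measurable fun τ => rearrangement g (τ / 2) ^ r :=
    ((rearrangement_antitone g).measurable.comp (measurable_id.div_const 2)).pow_const r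
  have hmain : ∫⁻ τ in Ioo 0 t, k τ * rearrangement (g + h) τ ^ r
      ≤ ENNReal.ofReal (2 ^ r * K) * (G + G') := by
    calc ∫⁻ τ in Ioo 0 t, k τ * rearrangement (g + h) τ ^ r
        ≤ ∫⁻ τ in Ioo 0 t, ENNReal.ofReal (2 ^ r) * (k τ * rearrangement g (τ / 2) ^ r +
            k τ * rearrangement h (τ / 2) ^ r) := by
          refine setLIntegral_mono' measurableSet_Ioo fun τ hτ => ?_
          have h1 := rearrangement_add_le g h (half_pos hτ.1).le (half_pos hτ.1).le
          rw [add_halves] at h1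
          calc k τ * rearrangement (g + h) τ ^ r
              ≤ k τ * (2 ^ r * (rearrangement g (τ / 2) ^ r + rearrangement h (τ / 2) ^ r)) := by
                gcongr
                exact (ENNReal.rpow_le_rpow h1 hr.le).trans (rpow_add_le_two_rpow_mul hr.le _ _)
            _ = _ := by
                rw [← ENNReal.ofReal_rpow_of_pos two_pos, ENNReal.ofReal_ofNat]
                ring
      _ ≤ ENNReal.ofReal (2 ^ r) * (ENNReal.ofReal K * G + ENNReal.ofReal K * G') := by
          have hm : AEMeasurable (fun τ => k τ * rearrangement g (τ / 2) ^ r)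
            (volume.restrict (Ioo 0 t)) := hkm.mul hgm.aemeasurable
          rw [lintegral_const_mul' _ _ ENNReal.ofReal_ne_top, lintegral_add_left' hm]
          gcongr
          · exact hscale g t
          · exact hscale h t
      _ = _ := by rw [ENNReal.ofReal_mul (p := 2 ^ r) (by positivity)]; ring
  calc _ ≤ (ENNReal.ofReal (2 ^ r * K) * (G + G')) ^ (1 / r) := by gcongr
    _ = ENNReal.ofReal (2 * K ^ (1 / r)) * (G + G') ^ (1 / r) := by
        rw [ENNReal.mul_rpow_of_nonneg _ _ (by positivity),
          ENNReal.ofReal_rpow_of_nonneg (by positivity) (by positivity),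
          Real.mul_rpow (by positivity) (by positivity), ← Real.rpow_mul two_pos.le,
          mul_one_div_cancel hr.ne', Real.rpow_one]
    _ ≤ ENNReal.ofReal (2 * K ^ (1 / r)) * (2 ^ (1 / r) * (G ^ (1 / r) + G' ^ (1 / r))) := by
        gcongr
        exact rpow_add_le_two_rpow_mul (by positivity) _ _
    _ = _ := by
        rw [ENNReal.ofReal_mul (p := 2 * K ^ (1 / r)) (by positivity),
          ← ENNReal.ofReal_rpow_of_pos (x := 2) two_pos, ENNReal.ofReal_ofNat, mul_assoc]

end InnerNorm

/-! ### A discrete Hardy inequality. -/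

section Hardy

theorem tsum_ofReal_geometric {x : ℝ} (h0 : 0 ≤ x) (h1 : x < 1) :
    ∑' n : ℕ, ENNReal.ofReal (x ^ n) = ENNReal.ofReal (1 - x)⁻¹ := by
  rw [← ENNReal.ofReal_tsum_of_nonneg (fun n => pow_nonneg h0 n)
    (summable_geometric_of_lt_one h0 h1), tsum_geometric_of_lt_one h0 h1]

/-- A power of a series is controlled by a geometrically weighted series of powers. -/
theorem tsum_rpow_le {s δ : ℝ} (hs : 0 < s) (hδ0 : 0 < δ) (hδ1 : δ < 1) :
    ∃ B > 0, ∀ y : ℕ → ℝ≥0∞,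
      (∑' n, y n) ^ s ≤ ENNReal.ofReal B * ∑' n, ENNReal.ofReal (δ⁻¹ ^ n) * y n ^ s := by
  -- Each term satisfies y_n ≤ β^n T^{1/s}, T being the weighted sum, and these bounds sum
  -- geometrically. No Hölder inequality enters, so all s > 0 are covered at once.
  set β := δ ^ (1 / s) with hβ
  have hβ0 : 0 < β := by positivity
  have hβ1 : β < 1 := Real.rpow_lt_one hδ0.le hδ1 (by positivity)
  have hβ2 : 0 < (1 - β)⁻¹ := inv_pos.2 (by linarith)
  refine ⟨(1 - β)⁻¹ ^ s, by positivity, fun y => ?_⟩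
  set T := ∑' n, ENNReal.ofReal (δ⁻¹ ^ n) * y n ^ s with hT
  have hy : ∀ n, y n ≤ ENNReal.ofReal (β ^ n) * T ^ (1 / s) := by
    intro n
    have h1 : ENNReal.ofReal (δ⁻¹ ^ n) * y n ^ s ≤ T :=
      ENNReal.le_tsum (f := fun n => ENNReal.ofReal (δ⁻¹ ^ n) * y n ^ s) n
    have h2 : y n ^ s ≤ ENNReal.ofReal (δ ^ n) * T := by
      calc y n ^ s = ENNReal.ofReal (δ ^ n) * (ENNReal.ofReal (δ⁻¹ ^ n) * y n ^ s) := by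
            rw [← mul_assoc, ← ENNReal.ofReal_mul (by positivity), ← mul_pow,
              mul_inv_cancel₀ hδ0.ne']
            simp
        _ ≤ _ := by gcongr
    calc y n = (y n ^ s) ^ (1 / s) := by
          rw [← ENNReal.rpow_mul, mul_one_div_cancel hs.ne', ENNReal.rpow_one]
      _ ≤ (ENNReal.ofReal (δ ^ n) * T) ^ (1 / s) := by gcongr
      _ = _ := by
          rw [ENNReal.mul_rpow_of_nonneg _ _ (by positivity),
            ENNReal.ofReal_rpow_of_pos (by positivity), hβ, ← Real.rpow_natCast,
            ← Real.rpow_natCast, ← Real.rpow_mul hδ0.le, ← Real.rpow_mul hδ0.le, mul_comm (1 / s)]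
  calc (∑' n, y n) ^ s ≤ (∑' n, ENNReal.ofReal (β ^ n) * T ^ (1 / s)) ^ s := by
        gcongr with n
        exact hy n
    _ = _ := by
        rw [ENNReal.tsum_mul_right, tsum_ofReal_geometric hβ0.le hβ1,
          ENNReal.mul_rpow_of_nonneg _ _ hs.le, ← ENNReal.rpow_mul, one_div_mul_cancel hs.ne',
          ENNReal.rpow_one, ENNReal.ofReal_rpow_of_pos hβ2]

/-- A discrete Hardy inequality with geometrically varying weights. -/
theorem tsum_hardy {s γ C : ℝ} (hs : 0 < s) (hγ0 : 0 < γ) (hγ1 : γ < 1) (hC : 0 < C) :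
    ∃ K > 0, ∀ (V y : ℤ → ℝ≥0∞) (e : ℤ),
      (∀ (k : ℤ) (n : ℕ), V k ≤ ENNReal.ofReal (C * γ ^ n) * V (k + e * n)) →
      ∑' k, V k * (∑' n : ℕ, y (k + e * n)) ^ s ≤ ENNReal.ofReal K * ∑' k, V k * y k ^ s := by
  -- Half of the decay of V pays for the weights δ^{-n} of `tsum_rpow_le`; the other half, δ^n,
  -- makes the sum over n converge after the order of summation is exchanged.
  set δ := √γ with hδ
  have hδ0 : 0 < δ := Real.sqrt_pos.2 hγ0
  have hδ1 : δ < 1 := by rw [hδ, Real.sqrt_lt' one_pos]; simpa using hγ1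
  have hδ2 : δ * δ = γ := Real.mul_self_sqrt hγ0.le
  have hδ3 : 0 < (1 - δ)⁻¹ := inv_pos.2 (by linarith)
  obtain ⟨B, hB, HB⟩ := tsum_rpow_le hs hδ0 hδ1
  refine ⟨B * (C * (1 - δ)⁻¹), by positivity, fun V y e hV => ?_⟩
  set S := ∑' k, V k * y k ^ s with hS
  calc ∑' k, V k * (∑' n : ℕ, y (k + e * n)) ^ s
      ≤ ∑' k, V k * (ENNReal.ofReal B *
          ∑' n : ℕ, ENNReal.ofReal (δ⁻¹ ^ n) * y (k + e * n) ^ s) := by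
        gcongr with k
        exact HB _
    _ = ENNReal.ofReal B *
          ∑' k, ∑' n : ℕ, V k * (ENNReal.ofReal (δ⁻¹ ^ n) * y (k + e * n) ^ s) := by
        rw [← ENNReal.tsum_mul_left]
        congr 1 with k
        rw [ENNReal.tsum_mul_left]
        ring
    _ = ENNReal.ofReal B *
          ∑' n : ℕ, ∑' k, V k * (ENNReal.ofReal (δ⁻¹ ^ n) * y (k + e * n) ^ s) := by
        rw [ENNReal.tsum_comm]
    _ ≤ ENNReal.ofReal B * ∑' n : ℕ, ∑' k : ℤ, ENNReal.ofReal (C * δ ^ n) *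
          (V (k + e * n) * y (k + e * n) ^ s) := by
        refine mul_le_mul_right (ENNReal.tsum_le_tsum fun n => ENNReal.tsum_le_tsum fun k => ?_) _
        calc V k * (ENNReal.ofReal (δ⁻¹ ^ n) * y (k + e * n) ^ s)
            ≤ (ENNReal.ofReal (C * γ ^ n) * V (k + e * n)) *
                (ENNReal.ofReal (δ⁻¹ ^ n) * y (k + e * n) ^ s) := by
              gcongr
              exact hV k n
          _ = (ENNReal.ofReal (C * γ ^ n) * ENNReal.ofReal (δ⁻¹ ^ n)) *
                (V (k + e * n) * y (k + e * n) ^ s) := by ring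
          _ = _ := by
              rw [← ENNReal.ofReal_mul (by positivity), ← hδ2, mul_pow, inv_pow]
              congr 2
              field_simp
    _ = ENNReal.ofReal B * ∑' n : ℕ, ENNReal.ofReal (C * δ ^ n) * S := by
        congr 2 with n
        rw [ENNReal.tsum_mul_left]
        congr 1
        exact (Equiv.addRight (e * (n : ℤ))).tsum_eq fun k => V k * y k ^ s
    _ = _ := by
        simp_rw [ENNReal.ofReal_mul hC.le]
        rw [ENNReal.tsum_mul_right, ENNReal.tsum_mul_left, tsum_ofReal_geometric hδ0.le hδ1,
          ENNReal.ofReal_mul hB.le, ENNReal.ofReal_mul hC.le]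
        ring

end Hardy

/-! ### Cutting (0,∞) along a two-sided sequence. -/

section Partition

variable {t : ℤ → ℝ}

theorem exists_mem_Ioc_int (hmono : Monotone t) (hlow : ∀ x, 0 < x → ∃ k, t k < x)
    (hup : ∀ x, ∃ k, x ≤ t k) {x : ℝ} (hx : 0 < x) : ∃ k, x ∈ Ioc (t k) (t (k + 1)) := by
  obtain ⟨m, hm⟩ := hup x
  obtain ⟨k, hk, hkmax⟩ := Int.exists_greatest_of_bdd (P := fun k => t k < x)
    ⟨m, fun z hz => by
      by_contra! h
      exact absurd (hm.trans (hmono h.le)) (not_le.2 hz)⟩ (hlow x hx)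
  refine ⟨k, hk, ?_⟩
  by_contra! h
  have := hkmax (k + 1) h
  omega

theorem lintegral_Ioi_eq_tsum (hmono : Monotone t) (hpos : ∀ k, 0 < t k)
    (hlow : ∀ x, 0 < x → ∃ k, t k < x) (hup : ∀ x, ∃ k, x ≤ t k) (g : ℝ → ℝ≥0∞) :
    ∫⁻ u in Ioi 0, g u = ∑' k, ∫⁻ u in Ioc (t k) (t (k + 1)), g u := by
  have hU : Ioi (0 : ℝ) = ⋃ k, Ioc (t k) (t (k + 1)) := by
    ext x
    rw [mem_iUnion]
    exact ⟨fun hx => exists_mem_Ioc_int hmono hlow hup hx, fun ⟨k, hk⟩ => (hpos k).trans hk.1⟩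
  rw [hU]
  exact lintegral_iUnion (fun _ => measurableSet_Ioc) hmono.pairwise_disjoint_on_Ioc_succ g

/-- The index is written `k + 1 * n` so that `tsum_hardy` applies with step e = 1; the integral over
(0, t k] uses e = -1 in the same way. -/
theorem lintegral_Ioi_le_tsum (hmono : Monotone t) (hpos : ∀ k, 0 < t k)
    (hlow : ∀ x, 0 < x → ∃ k, t k < x) (hup : ∀ x, ∃ k, x ≤ t k) (g : ℝ → ℝ≥0∞) (k : ℤ) :
    ∫⁻ u in Ioi (t k), g u ≤
      ∑' n : ℕ, ∫⁻ u in Ioc (t (k + 1 * n)) (t (k + 1 * n + 1)), g u := by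
  refine le_trans (lintegral_mono_set fun x hx => ?_) (lintegral_iUnion_le _ _)
  obtain ⟨j, hj⟩ := exists_mem_Ioc_int hmono hlow hup ((hpos k).trans hx)
  have hkj : k ≤ j := by
    by_contra! h
    exact absurd (hj.2.trans (hmono (show j + 1 ≤ k by omega))) (not_le.2 hx)
  obtain ⟨n, rfl⟩ := Int.le.dest hkj
  exact mem_iUnion.2 ⟨n, by simpa using hj⟩

theorem lintegral_Ioc_zero_le_tsum (hmono : Monotone t)
    (hlow : ∀ x, 0 < x → ∃ k, t k < x) (hup : ∀ x, ∃ k, x ≤ t k) (g : ℝ → ℝ≥0∞) (k : ℤ) :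
    ∫⁻ u in Ioc 0 (t k), g u ≤
      ∑' n : ℕ, ∫⁻ u in Ioc (t (k + (-1) * n - 1)) (t (k + (-1) * n)), g u := by
  refine le_trans (lintegral_mono_set fun x hx => ?_) (lintegral_iUnion_le _ _)
  obtain ⟨j, hj⟩ := exists_mem_Ioc_int hmono hlow hup hx.1
  have hkj : j + 1 ≤ k := by
    by_contra! h
    exact absurd (hx.2.trans (hmono (show k ≤ j by omega))) (not_le.2 hj.1)
  obtain ⟨n, hn⟩ := Int.le.dest hkj
  refine mem_iUnion.2 ⟨n, ?_⟩
  have h1 : k + (-1) * (n : ℤ) = j + 1 := by omega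
  simp only [h1, add_sub_cancel_right]
  exact hj

end Partition

/-! ### Elementary properties of the K-functional. -/

section KFunctional

variable {V : Type*} [AddCommGroup V] {N₀ N₁ : V → ℝ≥0∞} {s t : ℝ} {f : V}

/-- No finiteness of the summands is asked for: if one has infinite norm, the right-hand side is ∞
because s > 0. -/
theorem kFunctional_le (hs : 0 < s) {f₀ f₁ : V} (hf : f = f₀ + f₁) :
    kFunctional N₀ N₁ s f ≤ N₀ f₀ + ENNReal.ofReal s * N₁ f₁ := by
  by_cases h₀ : N₀ f₀ = ∞
  · simp [h₀]
  by_cases h₁ : N₁ f₁ = ∞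
  · simp [h₁, ENNReal.mul_top, hs]
  exact iInf₂_le_of_le f₀ (lt_top_iff_ne_top.2 h₀)
    (iInf₂_le_of_le f₁ (lt_top_iff_ne_top.2 h₁) (iInf_le _ hf))

theorem le_kFunctional {a : ℝ≥0∞}
    (h : ∀ f₀ f₁, f = f₀ + f₁ → a ≤ N₀ f₀ + ENNReal.ofReal s * N₁ f₁) :
    a ≤ kFunctional N₀ N₁ s f :=
  le_iInf₂ fun f₀ _ => le_iInf₂ fun f₁ _ => le_iInf fun hf => h f₀ f₁ hf

theorem kFunctional_mono (hst : s ≤ t) : kFunctional N₀ N₁ s f ≤ kFunctional N₀ N₁ t f := by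
  unfold kFunctional
  gcongr

/-- The function t ↦ K(t,f)/t is non-increasing: scaling a decomposition by s/t ≤ 1 turns t into s
in the second term and only shrinks the first. -/
theorem kFunctional_le_mul (hs : 0 < s) (hst : s ≤ t) :
    kFunctional N₀ N₁ t f ≤ ENNReal.ofReal (t / s) * kFunctional N₀ N₁ s f := by
  have ht := hs.trans_le hst
  have hinv : kFunctional N₀ N₁ t f * ENNReal.ofReal (s / t) ≤ kFunctional N₀ N₁ s f := by
    refine le_kFunctional fun f₀ f₁ hf => ?_
    calc kFunctional N₀ N₁ t f * ENNReal.ofReal (s / t)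
        ≤ (N₀ f₀ + ENNReal.ofReal t * N₁ f₁) * ENNReal.ofReal (s / t) := by
          gcongr
          exact kFunctional_le ht hf
      _ = N₀ f₀ * ENNReal.ofReal (s / t) + (ENNReal.ofReal t * ENNReal.ofReal (s / t)) * N₁ f₁ := by
          ring
      _ ≤ N₀ f₀ * 1 + ENNReal.ofReal s * N₁ f₁ := by
          rw [← ENNReal.ofReal_mul ht.le, mul_div_cancel₀ _ ht.ne']
          gcongr
          rw [ENNReal.ofReal_le_one]
          exact (div_le_one ht).2 hst
      _ = _ := by rw [mul_one]
  calc kFunctional N₀ N₁ t f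
      = ENNReal.ofReal (t / s) * (kFunctional N₀ N₁ t f * ENNReal.ofReal (s / t)) := by
        rw [mul_comm (kFunctional _ _ _ _), ← mul_assoc, ← ENNReal.ofReal_mul (by positivity),
          div_mul_div_cancel₀ hs.ne', div_self ht.ne', ENNReal.ofReal_one, one_mul]
    _ ≤ _ := by gcongr

theorem mem_sumSet_of_kFunctional_lt_top (h : kFunctional N₀ N₁ s f < ∞) :
    f ∈ sumSet N₀ N₁ := by
  simp only [kFunctional, iInf_lt_iff] at h
  obtain ⟨f₀, h₀, f₁, h₁, hf, -⟩ := h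
  exact ⟨f₀, h₀, f₁, h₁, hf⟩

end KFunctional

/-! ### Gamma norms and tail norms. -/

section Gamma

variable {Ω : Type*} [MeasurableSpace Ω] {μ : Measure Ω} {r p q : ℝ} {b w : ℝ → ℝ}

theorem gammaNorm_eq (hq : 0 < q) (hb : ∀ t, 0 < t → 0 < b t) (f : Ω →ₘ[μ] ℝ) :
    gammaNorm r q p b w f =
      (∫⁻ u in Ioi 0, ENNReal.ofReal (b u ^ q / u) * innerNorm r p w f u ^ q) ^ (1 / q) := by
  unfold gammaNorm lqNorm
  congr 1
  refine setLIntegral_congr_fun measurableSet_Ioi fun u hu => ?_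
  simp only
  rw [ENNReal.mul_rpow_of_nonneg _ _ hq.le, ofReal_weight_rpow hq hu (hb u hu).le]
  rfl

theorem tailMass_mul_le {F : ℝ → ℝ≥0∞} (hF : Monotone F) (hq : 0 < q) (t : ℝ) :
    tailMass q b t * F t ^ q ≤ ∫⁻ u in Ioi t, ENNReal.ofReal (b u ^ q / u) * F u ^ q := by
  refine (lintegral_mul_const_le _ _).trans ?_
  refine setLIntegral_mono' measurableSet_Ioi fun u hu => ?_
  gcongr
  exact hF (le_of_lt hu)

/-- On (t,∞) the increasing F is at least F(t), which leaves the tail norm as a factor. This is the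
source of every estimate of a(t)F(t) by a norm. -/
theorem tailNorm_mul_le {F : ℝ → ℝ≥0∞} (hF : Monotone F) (hq : 0 < q) (hb : IsSV0 q b) {t : ℝ}
    (ht : 0 < t) : ENNReal.ofReal (tailNorm q b t) * F t ≤
      (∫⁻ u in Ioi t, ENNReal.ofReal (b u ^ q / u) * F u ^ q) ^ (1 / q) := by
  have h0 := tailNorm_pos hq hb ht
  calc ENNReal.ofReal (tailNorm q b t) * F t = (tailMass q b t * F t ^ q) ^ (1 / q) := by
        rw [← ofReal_tailNorm_rpow hq hb ht, ← ENNReal.ofReal_rpow_of_pos h0,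
          ← ENNReal.mul_rpow_of_nonneg _ _ hq.le, ← ENNReal.rpow_mul, mul_one_div_cancel hq.ne',
          ENNReal.rpow_one]
    _ ≤ _ := ENNReal.rpow_le_rpow (tailMass_mul_le hF hq t) (by positivity)

theorem tailNorm_mul_innerNorm_le (hq : 0 < q) (hr : 0 < r) (hb : IsSV0 q b) {t : ℝ} (ht : 0 < t)
    (f : Ω →ₘ[μ] ℝ) :
    ENNReal.ofReal (tailNorm q b t) * innerNorm r p w f t ≤ gammaNorm r q p b w f := by
  rw [gammaNorm_eq hq hb.isSV.pos]
  refine (tailNorm_mul_le (innerNorm_monotone hr f) hq hb ht).trans ?_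
  exact ENNReal.rpow_le_rpow (lintegral_mono_set (Ioi_subset_Ioi ht.le)) (by positivity)

end Gamma

theorem ofReal_mul_ofReal_mul {x : ℝ} (hx : 0 ≤ x) (y : ℝ) (z : ℝ≥0∞) :
    ENNReal.ofReal x * (ENNReal.ofReal y * z) = ENNReal.ofReal (x * y) * z := by
  rw [← mul_assoc, ENNReal.ofReal_mul hx]

/-! ### Two-sided estimates of the K-functional at ρ(t). -/

section Bounds

variable {Ω : Type*} [MeasurableSpace Ω] {μ : Measure Ω} {r p q q₀ q₁ : ℝ} {b b₀ b₁ w : ℝ → ℝ}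

/-- The quasi-norm of a function whose rearrangement vanishes after `t`. -/
theorem gammaNorm_le_of_vanish (hq : 0 < q) (hr : 0 < r) (hb : IsSV0 q b) {f g : Ω →ₘ[μ] ℝ}
    {t : ℝ} (ht : 0 < t) (hgf : ∀ τ, rearrangement g τ ≤ rearrangement f τ)
    (hg : ∀ τ, t ≤ τ → rearrangement g τ = 0) :
    gammaNorm r q p b w g ≤ 2 ^ (1 / q) *
      ((∫⁻ u in Ioc 0 t, ENNReal.ofReal (b u ^ q / u) * innerNorm r p w f u ^ q) ^ (1 / q) +
        ENNReal.ofReal (tailNorm q b t) * innerNorm r p w f t) := by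
  have h0 := tailNorm_pos hq hb ht
  have hsecond : ENNReal.ofReal (tailNorm q b t) * innerNorm r p w f t
      = (tailMass q b t * innerNorm r p w f t ^ q) ^ (1 / q) := by
    rw [← ofReal_tailNorm_rpow hq hb ht, ← ENNReal.ofReal_rpow_of_pos h0,
      ← ENNReal.mul_rpow_of_nonneg _ _ hq.le, ← ENNReal.rpow_mul, mul_one_div_cancel hq.ne',
      ENNReal.rpow_one]
  rw [hsecond, gammaNorm_eq hq hb.isSV.pos]
  refine le_trans ?_ (rpow_add_le_two_rpow_mul (by positivity) _ _)
  refine ENNReal.rpow_le_rpow ?_ (by positivity)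
  rw [← Ioc_union_Ioi_eq_Ioi ht.le]
  -- Beyond t the inner norm of g is frozen at its value at t, so that range contributes at most the
  -- tail mass times the inner norm of f at t.
  refine (lintegral_union_le _ _ _).trans (add_le_add ?_ ?_)
  · refine lintegral_mono fun u => ?_
    gcongr
    exact innerNorm_mono hr hgf u
  · by_cases htop : innerNorm r p w f t ^ q = ∞
    · have : tailMass q b t ≠ 0 := by
        have := tailMass_toReal_pos hq hb ht
        exact fun h => by simp [h] at this
      rw [htop, ENNReal.mul_top this]
      exact le_top
    · rw [tailMass, ← lintegral_mul_const' _ _ htop]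
      refine lintegral_mono fun u => ?_
      gcongr
      exact (innerNorm_le_of_vanish hr hg u).trans (innerNorm_mono hr hgf t)

/-- The quasi-norm of a function truncated at the height `f^*(t)`. -/
theorem gammaNorm_le_of_bounded (hq : 0 < q) (hr : 0 < r) (hp : 0 < p) (hb : IsSV0 q b)
    (hw : Potter w) :
    ∃ C > 0, ∀ (f g : Ω →ₘ[μ] ℝ) (t : ℝ), 0 < t → rearrangement f t ≠ ∞ →
      (∀ τ, rearrangement g τ ≤ rearrangement f τ) →
      (∀ τ, rearrangement g τ ≤ rearrangement f t) →
      gammaNorm r q p b w g ≤ ENNReal.ofReal C *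
        (∫⁻ u in Ioi t, ENNReal.ofReal (b u ^ q / u) * innerNorm r p w f u ^ q) ^ (1 / q) := by
  obtain ⟨C₁, hC₁, H₁⟩ := innerNorm_le_of_bounded (μ := μ) hr hp hw
  obtain ⟨c₂, hc₂, H₂⟩ := rearrangement_le_innerNorm (μ := μ) (p := p) hr hw
  obtain ⟨C₃, hC₃, H₃⟩ := lintegral_rpow_mul_le ((hb.isSV.potter.rpow q).mul (hw.rpow q))
    (div_pos hq hp)
  obtain ⟨C₄, hC₄, H₄⟩ := le_tailNorm hq hb
  -- The part over (0,t) is absorbed by the tail: boundedness of g^* (C₁) and integration of the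
  -- power weight (C₃) leave t^{q/p} b(t)^q w(t)^q f^*(t)^q; then t^{1/p} w(t) f^*(t) is controlled
  -- by the inner norm (c₂) and b(t)^q by the tail norm (C₄).
  set K := C₁ ^ q * (C₃ * (c₂⁻¹ ^ q * C₄)) with hK
  have hKpos : 0 < K := by positivity
  refine ⟨(K + 1) ^ (1 / q), by positivity, fun f g t ht hfin hgf hgt => ?_⟩
  set A := rearrangement f t with hA
  set Y := ∫⁻ u in Ioi t, ENNReal.ofReal (b u ^ q / u) * innerNorm r p w f u ^ q with hY
  have hAq : A ^ q ≠ ∞ := ENNReal.rpow_ne_top_of_nonneg hq.le hfin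
  have hbt := hb.isSV.pos t ht
  have hwt := hw.pos t ht
  have hat := tailNorm_pos hq hb ht
  have hfirst : ∫⁻ u in Ioc 0 t, ENNReal.ofReal (b u ^ q / u) * innerNorm r p w g u ^ q
      ≤ ENNReal.ofReal K * Y := by
    calc ∫⁻ u in Ioc 0 t, ENNReal.ofReal (b u ^ q / u) * innerNorm r p w g u ^ q
        = ∫⁻ u in Ioo 0 t, ENNReal.ofReal (b u ^ q / u) * innerNorm r p w g u ^ q :=
          setLIntegral_congr Ioo_ae_eq_Ioc.symm
      _ ≤ ∫⁻ u in Ioo 0 t, ENNReal.ofReal (C₁ ^ q) *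
            (ENNReal.ofReal (u ^ (q / p - 1) * (b u ^ q * w u ^ q)) * A ^ q) := by
          refine setLIntegral_mono' measurableSet_Ioo fun u hu => ?_
          have hu0 := hu.1
          have hbu := hb.isSV.pos u hu0
          have hwu := hw.pos u hu0
          calc ENNReal.ofReal (b u ^ q / u) * innerNorm r p w g u ^ q
              ≤ ENNReal.ofReal (b u ^ q / u) *
                  (ENNReal.ofReal (C₁ * (u ^ (1 / p) * w u)) * A) ^ q := by
                gcongr
                exact H₁ g A hgt u hu0
            _ = _ := by
                rw [ENNReal.mul_rpow_of_nonneg _ _ hq.le,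
                  ENNReal.ofReal_rpow_of_pos (by positivity),
                  ofReal_mul_ofReal_mul (by positivity), ofReal_mul_ofReal_mul (by positivity),
                  Real.mul_rpow hC₁.le (by positivity), Real.mul_rpow (by positivity) hwu.le,
                  ← Real.rpow_mul hu0.le, Real.rpow_sub_one hu0.ne', one_div_mul_eq_div]
                congr 2
                ring
      _ = ENNReal.ofReal (C₁ ^ q) *
            ((∫⁻ u in Ioo 0 t, ENNReal.ofReal (u ^ (q / p - 1) * (b u ^ q * w u ^ q))) * A ^ q) := by
          rw [lintegral_const_mul' _ _ ENNReal.ofReal_ne_top, lintegral_mul_const' _ _ hAq]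
      _ ≤ ENNReal.ofReal (C₁ ^ q) *
            (ENNReal.ofReal (C₃ * (t ^ (q / p) * (b t ^ q * w t ^ q))) * A ^ q) := by
          gcongr
          exact H₃ t ht
      _ = ENNReal.ofReal (C₁ ^ q * (C₃ * (c₂⁻¹ ^ q * b t ^ q))) *
            (ENNReal.ofReal (c₂ * (t ^ (1 / p) * w t)) * A) ^ q := by
          rw [ENNReal.mul_rpow_of_nonneg _ _ hq.le,
            ENNReal.ofReal_rpow_of_pos (by positivity),
            ofReal_mul_ofReal_mul (by positivity), ofReal_mul_ofReal_mul (by positivity),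
            Real.mul_rpow hc₂.le (by positivity), Real.mul_rpow (by positivity) hwt.le,
            ← Real.rpow_mul ht.le, one_div_mul_eq_div, Real.inv_rpow hc₂.le]
          have : 0 < c₂ ^ q := by positivity
          congr 2
          field_simp
      _ ≤ ENNReal.ofReal (C₁ ^ q * (C₃ * (c₂⁻¹ ^ q * (C₄ * tailNorm q b t ^ q)))) *
            innerNorm r p w f t ^ q := by
          have := H₄ t ht
          gcongr
          exact H₂ f t ht
      _ = ENNReal.ofReal K * (tailMass q b t * innerNorm r p w f t ^ q) := by
          rw [← ofReal_tailNorm_rpow hq hb ht, ofReal_mul_ofReal_mul hKpos.le, hK]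
          congr 2
          ring
      _ ≤ ENNReal.ofReal K * Y := by
          gcongr
          exact tailMass_mul_le (innerNorm_monotone hr f) hq t
  rw [gammaNorm_eq hq hb.isSV.pos, ← Ioc_union_Ioi_eq_Ioi ht.le]
  calc _ ≤ (ENNReal.ofReal K * Y + Y) ^ (1 / q) := by
        refine ENNReal.rpow_le_rpow ?_ (by positivity)
        refine (lintegral_union_le _ _ _).trans (add_le_add hfirst ?_)
        refine lintegral_mono fun u => ?_
        gcongr
        exact innerNorm_mono hr hgf u
    _ = _ := by
        rw [← ENNReal.ofReal_rpow_of_pos (by positivity),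
          ← ENNReal.mul_rpow_of_nonneg _ _ (by positivity), ENNReal.ofReal_add hKpos.le zero_le_one,
          ENNReal.ofReal_one, add_mul, one_mul]

theorem rho_pos (hq₀ : 0 < q₀) (hq₁ : 0 < q₁) (hb₀ : IsSV0 q₀ b₀) (hb₁ : IsSV0 q₁ b₁) {t : ℝ}
    (ht : 0 < t) : 0 < rho q₀ q₁ b₀ b₁ t :=
  div_pos (tailNorm_pos hq₀ hb₀ ht) (tailNorm_pos hq₁ hb₁ ht)

theorem tailNorm_eq_rho_mul (hq₁ : 0 < q₁) (hb₁ : IsSV0 q₁ b₁) {t : ℝ}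
    (ht : 0 < t) : tailNorm q₀ b₀ t = rho q₀ q₁ b₀ b₁ t * tailNorm q₁ b₁ t :=
  (div_mul_cancel₀ _ (tailNorm_pos hq₁ hb₁ ht).ne').symm

/-- Upper estimate for the `K`-functional of a pair of gamma spaces. -/
theorem kFunctional_rho_le (hq₀ : 0 < q₀) (hq₁ : 0 < q₁) (hr : 0 < r) (hp : 0 < p)
    (hb₀ : IsSV0 q₀ b₀) (hb₁ : IsSV0 q₁ b₁) (hw : Potter w) :
    ∃ C > 0, ∀ (f : Ω →ₘ[μ] ℝ) (t : ℝ), 0 < t →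
      kFunctional (gammaNorm r q₀ p b₀ w) (gammaNorm r q₁ p b₁ w) (rho q₀ q₁ b₀ b₁ t) f ≤
        ENNReal.ofReal C *
        ((∫⁻ u in Ioc 0 t, ENNReal.ofReal (b₀ u ^ q₀ / u) * innerNorm r p w f u ^ q₀) ^ (1 / q₀) +
          ENNReal.ofReal (rho q₀ q₁ b₀ b₁ t) *
          (∫⁻ u in Ioi t, ENNReal.ofReal (b₁ u ^ q₁ / u) * innerNorm r p w f u ^ q₁)
            ^ (1 / q₁)) := by
  obtain ⟨C₁, hC₁, H₁⟩ := gammaNorm_le_of_bounded (μ := μ) hq₁ hr hp hb₁ hw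
  obtain ⟨c₂, hc₂, H₂⟩ := rearrangement_le_innerNorm (μ := μ) (p := p) hr hw
  have hC : 0 < 2 ^ (1 / q₀) + C₁ := by positivity
  refine ⟨2 ^ (1 / q₀) + C₁, hC, fun f t ht => ?_⟩
  set X := (∫⁻ u in Ioc 0 t, ENNReal.ofReal (b₀ u ^ q₀ / u) * innerNorm r p w f u ^ q₀) ^ (1 / q₀)
  set Y := (∫⁻ u in Ioi t, ENNReal.ofReal (b₁ u ^ q₁ / u) * innerNorm r p w f u ^ q₁) ^ (1 / q₁)
  set R := rho q₀ q₁ b₀ b₁ t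
  have hR : 0 < R := rho_pos hq₀ hq₁ hb₀ hb₁ ht
  have hY : ENNReal.ofReal (tailNorm q₁ b₁ t) * innerNorm r p w f t ≤ Y :=
    tailNorm_mul_le (innerNorm_monotone hr f) hq₁ hb₁ ht
  -- Truncation needs a finite height. If f^*(t) = ∞, the inner norm at t and hence Y are infinite,
  -- and the estimate is trivial.
  by_cases hfin : rearrangement f t = ∞
  · have hwt := hw.pos t ht
    have h1 : innerNorm r p w f t = ∞ := by
      have := H₂ f t ht
      rw [hfin, ENNReal.mul_top (ENNReal.ofReal_pos.2 (by positivity)).ne'] at this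
      exact top_le_iff.1 this
    rw [h1, ENNReal.mul_top (ENNReal.ofReal_pos.2 (tailNorm_pos hq₁ hb₁ ht)).ne'] at hY
    rw [top_le_iff.1 hY, ENNReal.mul_top (ENNReal.ofReal_pos.2 hR).ne', add_top,
      ENNReal.mul_top (ENNReal.ofReal_pos.2 hC).ne']
    exact le_top
  obtain ⟨f₀, f₁, hf, h₀, h₁, hvan, hbdd⟩ := exists_truncation f hfin
  have hN₀ : gammaNorm r q₀ p b₀ w f₀ ≤ ENNReal.ofReal (2 ^ (1 / q₀)) *
      (X + ENNReal.ofReal R * Y) := by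
    refine (gammaNorm_le_of_vanish hq₀ hr hb₀ ht h₀ hvan).trans ?_
    -- Since a_0 = ρ a_1, the boundary term a_0(t)F(t) left by truncation is at most ρ(t)Y.
    rw [tailNorm_eq_rho_mul hq₁ hb₁ ht, ENNReal.ofReal_mul hR.le, mul_assoc,
      ← ENNReal.ofReal_rpow_of_pos two_pos, ENNReal.ofReal_ofNat]
    gcongr
  calc _ ≤ gammaNorm r q₀ p b₀ w f₀ + ENNReal.ofReal R * gammaNorm r q₁ p b₁ w f₁ :=
        kFunctional_le hR hf
    _ ≤ ENNReal.ofReal (2 ^ (1 / q₀)) * (X + ENNReal.ofReal R * Y) +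
          ENNReal.ofReal R * (ENNReal.ofReal C₁ * Y) := by
        gcongr
        exact H₁ f f₁ t ht hfin h₁ hbdd
    _ = ENNReal.ofReal (2 ^ (1 / q₀)) * (X + ENNReal.ofReal R * Y) +
          ENNReal.ofReal C₁ * (ENNReal.ofReal R * Y) := by ring
    _ ≤ ENNReal.ofReal (2 ^ (1 / q₀)) * (X + ENNReal.ofReal R * Y) +
          ENNReal.ofReal C₁ * (X + ENNReal.ofReal R * Y) := by
        gcongr
        exact le_add_self
    _ = _ := by rw [ENNReal.ofReal_add (by positivity) hC₁.le, add_mul]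

/-- Lower estimate for the `K`-functional of a pair of gamma spaces. -/
theorem le_kFunctional_rho (hq₀ : 0 < q₀) (hq₁ : 0 < q₁) (hr : 0 < r)
    (hb₀ : IsSV0 q₀ b₀) (hb₁ : IsSV0 q₁ b₁) (hw : IsSV w) :
    ∃ c > 0, ∀ (f : Ω →ₘ[μ] ℝ) (t : ℝ), 0 < t →
      ENNReal.ofReal c * (ENNReal.ofReal (tailNorm q₀ b₀ t) * innerNorm r p w f t) ≤
        kFunctional (gammaNorm r q₀ p b₀ w) (gammaNorm r q₁ p b₁ w) (rho q₀ q₁ b₀ b₁ t) f := by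
  obtain ⟨C, hC, H⟩ := innerNorm_add_le (μ := μ) (p := p) hr hw
  refine ⟨C⁻¹, by positivity, fun f t ht => le_kFunctional fun g h hf => ?_⟩
  have hR : 0 < rho q₀ q₁ b₀ b₁ t := rho_pos hq₀ hq₁ hb₀ hb₁ ht
  calc ENNReal.ofReal C⁻¹ * (ENNReal.ofReal (tailNorm q₀ b₀ t) * innerNorm r p w f t)
      ≤ ENNReal.ofReal C⁻¹ * (ENNReal.ofReal (tailNorm q₀ b₀ t) *
          (ENNReal.ofReal C * (innerNorm r p w g t + innerNorm r p w h t))) := by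
        rw [hf]
        gcongr
        exact H g h t
    _ = ENNReal.ofReal C⁻¹ * ENNReal.ofReal C *
          (ENNReal.ofReal (tailNorm q₀ b₀ t) * innerNorm r p w g t +
          ENNReal.ofReal (tailNorm q₀ b₀ t) * innerNorm r p w h t) := by ring
    -- For h the factor a_0 is rewritten as ρ a_1, which produces the coefficient of the
    -- K-functional.
    _ = ENNReal.ofReal (tailNorm q₀ b₀ t) * innerNorm r p w g t +
          ENNReal.ofReal (rho q₀ q₁ b₀ b₁ t) *
          (ENNReal.ofReal (tailNorm q₁ b₁ t) * innerNorm r p w h t) := by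
        rw [← ENNReal.ofReal_mul (by positivity), inv_mul_cancel₀ hC.ne', ENNReal.ofReal_one,
          one_mul, ← mul_assoc (ENNReal.ofReal (rho _ _ _ _ _)), ← ENNReal.ofReal_mul hR.le,
          ← tailNorm_eq_rho_mul hq₁ hb₁ ht]
    _ ≤ _ := by
        gcongr
        · exact tailNorm_mul_innerNorm_le hq₀ hr hb₀ ht g
        · exact tailNorm_mul_innerNorm_le hq₁ hr hb₁ ht h

end Bounds

/-! ### The discretizing grid. -/

/-- A sequence of points along which the second tail norm decreases geometrically and `ρ`
increases geometrically. -/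
structure IsGrid (q₀ q₁ : ℝ) (b₀ b₁ : ℝ → ℝ) (M : ℝ) (t : ℤ → ℝ) : Prop where
  two_le : 2 ≤ M
  mono : Monotone t
  pos : ∀ k, 0 < t k
  low : ∀ x, 0 < x → ∃ k, t k < x
  up : ∀ x, ∃ k, x ≤ t k
  tail_eq : ∀ k, tailNorm q₁ b₁ (t k) = M * tailNorm q₁ b₁ (t (k + 1))
  two_mul_le : ∀ k, 2 * rho q₀ q₁ b₀ b₁ (t k) ≤ rho q₀ q₁ b₀ b₁ (t (k + 1))
  le_mul : ∀ k, rho q₀ q₁ b₀ b₁ (t (k + 1)) ≤ M * rho q₀ q₁ b₀ b₁ (t k)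

section Grid

variable {q₀ q₁ : ℝ} {b₀ b₁ : ℝ → ℝ}

theorem RhoCondition.exists_le (hcond : RhoCondition q₀ q₁ b₀ b₁) :
    ∃ ε > 0, ∃ κ > 0, ∀ s t : ℝ, 0 < s → s ≤ t →
      κ * rhoEps q₀ q₁ b₀ b₁ ε s ≤ rhoEps q₀ q₁ b₀ b₁ ε t := by
  obtain ⟨ε, hε, g, hg, c, hc, C, hC, H⟩ := hcond
  refine ⟨ε, hε, c / C, by positivity, fun s t hs hst => ?_⟩
  have ht := hs.trans_le hst
  calc c / C * rhoEps q₀ q₁ b₀ b₁ ε s ≤ c / C * (C * g s) := by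
        gcongr
        exact (H s hs).2
    _ = c * g s := by field_simp
    _ ≤ c * g t := by
        gcongr
        exact hg hs ht hst
    _ ≤ _ := (H t ht).1

/-- On (0,1) the numerator of ρ is at least its value at 1, so ρ → 0 forces the denominator to blow
up. -/
theorem exists_le_tailNorm (hq₀ : 0 < q₀) (hq₁ : 0 < q₁) (hb₀ : IsSV0 q₀ b₀) (hb₁ : IsSV0 q₁ b₁)
    (hzero : Filter.Tendsto (rho q₀ q₁ b₀ b₁) (nhdsWithin 0 (Ioi 0)) (nhds 0)) (K : ℝ) :
    ∃ t > 0, K ≤ tailNorm q₁ b₁ t := by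
  have h1 := tailNorm_pos hq₀ hb₀ one_pos
  have hK : 0 < max K 1 := by positivity
  have hev := hzero.eventually (gt_mem_nhds (show 0 < tailNorm q₀ b₀ 1 / max K 1 by positivity))
  have hlt : ∀ᶠ t : ℝ in nhdsWithin 0 (Ioi 0), t < 1 :=
    nhdsWithin_le_nhds (gt_mem_nhds one_pos)
  obtain ⟨t, ⟨ht, ht1⟩, ht0⟩ := ((hev.and hlt).and self_mem_nhdsWithin).exists
  have ht0' : 0 < t := ht0
  have ha1 := tailNorm_pos hq₁ hb₁ ht0'
  refine ⟨t, ht0', ?_⟩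
  have h2 := tailNorm_anti hq₀ hb₀ ht0' ht1.le
  rw [rho, div_lt_div_iff₀ ha1 hK] at ht
  have h3 : max K 1 < tailNorm q₁ b₁ t := by
    by_contra! h
    nlinarith
  exact (le_max_left _ _).trans h3.le

/-- The points solve a_1(t_k) = M^{-k}. Since ρ^{1+ε} = ρ_ε a_1^{-ε} and ρ_ε is almost increasing, a
drop of a_1 by the factor M raises ρ^{1+ε} by at least κM^ε; monotonicity of a_0 caps the growth of
ρ at M. -/
theorem exists_grid (hq₀ : 0 < q₀) (hq₁ : 0 < q₁) (hb₀ : IsSV0 q₀ b₀) (hb₁ : IsSV0 q₁ b₁)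
    (hcond : RhoCondition q₀ q₁ b₀ b₁)
    (hzero : Filter.Tendsto (rho q₀ q₁ b₀ b₁) (nhdsWithin 0 (Ioi 0)) (nhds 0)) :
    ∃ M t, IsGrid q₀ q₁ b₀ b₁ M t := by
  obtain ⟨ε, hε, κ, hκ, hκle⟩ := hcond.exists_le
  -- Chosen so that κM^ε ≥ 2^{1+ε}, which makes ρ at least double at each step.
  set M : ℝ := max 2 ((2 ^ (1 + ε) / κ) ^ (1 / ε)) with hM
  have hM2 : 2 ≤ M := le_max_left _ _
  have hM0 : 0 < M := by linarith
  have hM1 : 1 < M := by linarith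
  have hMκ : 2 ^ (1 + ε) ≤ κ * M ^ ε := by
    have h1 : ((2 ^ (1 + ε) / κ) ^ (1 / ε)) ^ ε ≤ M ^ ε := by
      gcongr
      exact le_max_right _ _
    rw [← Real.rpow_mul (by positivity), one_div_mul_cancel hε.ne', Real.rpow_one,
      div_le_iff₀ hκ] at h1
    linarith
  have hex : ∀ k : ℤ, ∃ t > 0, tailNorm q₁ b₁ t = M ^ (-k) := fun k =>
    exists_tailNorm_eq hq₁ hb₁ (exists_le_tailNorm hq₀ hq₁ hb₀ hb₁ hzero) (by positivity)
  choose t ht0 ht using hex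
  have hlt : ∀ {x y : ℝ}, 0 < y → tailNorm q₁ b₁ y < tailNorm q₁ b₁ x → x < y := by
    intro x y hy hxy
    by_contra! h
    exact absurd (tailNorm_anti hq₁ hb₁ hy h) (not_le.2 hxy)
  have hmono : Monotone t := by
    refine monotone_int_of_le_succ fun k => ?_
    refine (hlt (ht0 _) ?_).le
    rw [ht, ht]
    exact zpow_lt_zpow_right₀ hM1 (by omega)
  have htail : ∀ k, tailNorm q₁ b₁ (t k) = M * tailNorm q₁ b₁ (t (k + 1)) := fun k => by
    rw [ht, ht, neg_add, zpow_add₀ hM0.ne', zpow_neg_one]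
    field_simp
  refine ⟨M, t, hM2, hmono, ht0, fun x hx => ?_, fun x => ?_, htail, fun k => ?_, fun k => ?_⟩
  · obtain ⟨n, hn⟩ := pow_unbounded_of_one_lt (tailNorm q₁ b₁ x) hM1
    refine ⟨-n, hlt hx ?_⟩
    rw [ht, neg_neg, zpow_natCast]
    exact hn
  · rcases le_or_gt x 0 with hx | hx
    · exact ⟨0, hx.trans (ht0 0).le⟩
    have hax := tailNorm_pos hq₁ hb₁ hx
    obtain ⟨n, hn⟩ := pow_unbounded_of_one_lt (tailNorm q₁ b₁ x)⁻¹ hM1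
    refine ⟨n, (hlt (ht0 _) ?_).le⟩
    rw [ht, zpow_neg, zpow_natCast]
    exact inv_lt_of_inv_lt₀ hax hn
  · have h0 := ht0 k
    have h1 := ht0 (k + 1)
    have hρ0 := rho_pos hq₀ hq₁ hb₀ hb₁ h0
    have hρ1 := rho_pos hq₀ hq₁ hb₀ hb₁ h1
    have ha0 := tailNorm_pos hq₁ hb₁ h0
    have ha1 := tailNorm_pos hq₁ hb₁ h1
    have hid : ∀ x, 0 < x → rho q₀ q₁ b₀ b₁ x ^ (1 + ε) =
        rhoEps q₀ q₁ b₀ b₁ ε x * (tailNorm q₁ b₁ x ^ ε)⁻¹ := by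
      intro x hx
      have hA := tailNorm_pos hq₀ hb₀ hx
      have hB := tailNorm_pos hq₁ hb₁ hx
      rw [rho, rhoEps, Real.div_rpow hA.le hB.le, Real.rpow_add hB, Real.rpow_one]
      field_simp
    have hle : (2 * rho q₀ q₁ b₀ b₁ (t k)) ^ (1 + ε) ≤ rho q₀ q₁ b₀ b₁ (t (k + 1)) ^ (1 + ε) := by
      have hk := hκle (t k) (t (k + 1)) h0 (hmono (by omega))
      have hE : 0 < rhoEps q₀ q₁ b₀ b₁ ε (t k) := by
        have := tailNorm_pos hq₀ hb₀ h0
        rw [rhoEps]; positivity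
      calc (2 * rho q₀ q₁ b₀ b₁ (t k)) ^ (1 + ε)
          = 2 ^ (1 + ε) * (rhoEps q₀ q₁ b₀ b₁ ε (t k) * (tailNorm q₁ b₁ (t k) ^ ε)⁻¹) := by
            rw [Real.mul_rpow two_pos.le hρ0.le, hid _ h0]
        _ ≤ κ * M ^ ε * (rhoEps q₀ q₁ b₀ b₁ ε (t k) * (tailNorm q₁ b₁ (t k) ^ ε)⁻¹) := by gcongr
        _ = κ * rhoEps q₀ q₁ b₀ b₁ ε (t k) * (tailNorm q₁ b₁ (t (k + 1)) ^ ε)⁻¹ := by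
            rw [htail k, Real.mul_rpow hM0.le ha1.le]
            field_simp
        _ ≤ _ := by rw [hid _ h1]; gcongr
    exact (Real.rpow_le_rpow_iff (by positivity) hρ1.le (by positivity)).1 hle
  · have h1 := ht0 (k + 1)
    have ha1 := tailNorm_pos hq₁ hb₁ h1
    have := tailNorm_anti hq₀ hb₀ (ht0 k) (hmono (show k ≤ k + 1 by omega))
    rw [rho, rho, htail k, div_le_iff₀ ha1]
    calc _ ≤ tailNorm q₀ b₀ (t k) := this
      _ = _ := by field_simp

end Grid

namespace IsGrid

variable {q₀ q₁ M : ℝ} {b₀ b₁ : ℝ → ℝ} {t : ℤ → ℝ}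

theorem pow_mul_le (ht : IsGrid q₀ q₁ b₀ b₁ M t) (k : ℤ) (n : ℕ) :
    2 ^ n * rho q₀ q₁ b₀ b₁ (t k) ≤ rho q₀ q₁ b₀ b₁ (t (k + n)) := by
  induction n with
  | zero => simp
  | succ n ih =>
    have := ht.two_mul_le (k + n)
    rw [pow_succ, Nat.cast_succ, ← add_assoc]
    linarith

theorem rho_monotone (hq₀ : 0 < q₀) (hq₁ : 0 < q₁) (hb₀ : IsSV0 q₀ b₀) (hb₁ : IsSV0 q₁ b₁)
    (ht : IsGrid q₀ q₁ b₀ b₁ M t) : Monotone fun k => rho q₀ q₁ b₀ b₁ (t k) :=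
  monotone_int_of_le_succ fun k => by
    have := ht.two_mul_le k
    have := rho_pos hq₀ hq₁ hb₀ hb₁ (ht.pos k)
    linarith

theorem rho_low (ht : IsGrid q₀ q₁ b₀ b₁ M t) {x : ℝ} (hx : 0 < x) :
    ∃ k, rho q₀ q₁ b₀ b₁ (t k) < x := by
  obtain ⟨n, hn⟩ := pow_unbounded_of_one_lt (rho q₀ q₁ b₀ b₁ (t 0) / x) one_lt_two
  refine ⟨-n, ?_⟩
  have h := ht.pow_mul_le (-n) n
  rw [neg_add_cancel] at h
  rw [div_lt_iff₀ hx] at hn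
  exact lt_of_mul_lt_mul_left (h.trans_lt hn) (by positivity)

theorem rho_up (hq₀ : 0 < q₀) (hq₁ : 0 < q₁) (hb₀ : IsSV0 q₀ b₀) (hb₁ : IsSV0 q₁ b₁)
    (ht : IsGrid q₀ q₁ b₀ b₁ M t) (x : ℝ) : ∃ k, x ≤ rho q₀ q₁ b₀ b₁ (t k) := by
  have h0 := rho_pos hq₀ hq₁ hb₀ hb₁ (ht.pos 0)
  obtain ⟨n, hn⟩ := pow_unbounded_of_one_lt (x / rho q₀ q₁ b₀ b₁ (t 0)) one_lt_two
  refine ⟨0 + n, ?_⟩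
  rw [div_lt_iff₀ h0] at hn
  exact hn.le.trans (ht.pow_mul_le 0 n)

/-- In a_0 = ρ a_1 the second factor drops by exactly M from one point to the next, while ρ does not
decrease. -/
theorem tailNorm_le (hq₀ : 0 < q₀) (hq₁ : 0 < q₁) (hb₀ : IsSV0 q₀ b₀) (hb₁ : IsSV0 q₁ b₁)
    (ht : IsGrid q₀ q₁ b₀ b₁ M t) (k : ℤ) :
    tailNorm q₀ b₀ (t k) ≤ M * tailNorm q₀ b₀ (t (k + 1)) := by
  have hM : 0 < M := by linarith [ht.two_le]
  have h1 := tailNorm_pos hq₁ hb₁ (ht.pos (k + 1))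
  have hρ := rho_pos hq₀ hq₁ hb₀ hb₁ (ht.pos k)
  rw [tailNorm_eq_rho_mul hq₁ hb₁ (ht.pos k), tailNorm_eq_rho_mul hq₁ hb₁ (ht.pos (k + 1)),
    ht.tail_eq k]
  have h2 : rho q₀ q₁ b₀ b₁ (t k) ≤ rho q₀ q₁ b₀ b₁ (t (k + 1)) := by linarith [ht.two_mul_le k]
  calc _ = M * (rho q₀ q₁ b₀ b₁ (t k) * tailNorm q₁ b₁ (t (k + 1))) := by ring
    _ ≤ _ := by gcongr

/-- The mass of one block of the grid. -/
theorem lintegral_block (hq₁ : 0 < q₁) (hb₁ : IsSV0 q₁ b₁) (ht : IsGrid q₀ q₁ b₀ b₁ M t) (k : ℤ) :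
    ∫⁻ u in Ioc (t k) (t (k + 1)), ENNReal.ofReal (b₁ u ^ q₁ / u) =
      ENNReal.ofReal ((1 - (M ^ q₁)⁻¹) * tailNorm q₁ b₁ (t k) ^ q₁) := by
  have hM : 0 < M := by linarith [ht.two_le]
  have h1 := tailNorm_pos hq₁ hb₁ (ht.pos (k + 1))
  have hsplit : tailMass q₁ b₁ (t k) = (∫⁻ u in Ioc (t k) (t (k + 1)),
      ENNReal.ofReal (b₁ u ^ q₁ / u)) + tailMass q₁ b₁ (t (k + 1)) := by
    rw [tailMass, tailMass, ← lintegral_union measurableSet_Ioi,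
      Ioc_union_Ioi_eq_Ioi (ht.mono (by omega))]
    exact Ioc_disjoint_Ioi le_rfl
  have := ENNReal.eq_sub_of_add_eq (tailMass_lt_top hq₁ hb₁ (ht.pos (k + 1))).ne hsplit.symm
  rw [this, ← ofReal_tailNorm_rpow hq₁ hb₁ (ht.pos k), ← ofReal_tailNorm_rpow hq₁ hb₁ (ht.pos _),
    ← ENNReal.ofReal_sub _ (by positivity), ht.tail_eq k, Real.mul_rpow hM.le h1.le]
  congr 1
  have : 0 < M ^ q₁ := by positivity
  field_simp

end IsGrid

/-! ### Discretization of the interpolation norm. -/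

/-- The weight `s^{-θ q} b(s)^q`. -/
def kWeight (θ q : ℝ) (b : ℝ → ℝ) (s : ℝ) : ℝ :=
  s ^ (-(θ * q)) * b s ^ q

section KWeight

variable {θ q M : ℝ} {b : ℝ → ℝ}

theorem kWeight_pos (hb : Potter b) {s : ℝ} (hs : 0 < s) : 0 < kWeight θ q b s :=
  mul_pos (Real.rpow_pos_of_pos hs _) (Real.rpow_pos_of_pos (hb.pos s hs) _)

/-- Powers times slowly varying functions are comparable at comparable points. -/
theorem Potter.rpow_mul_cmp {v : ℝ → ℝ} (hv : Potter v) (α D : ℝ) : ∃ C > 0, ∀ x y : ℝ,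
    0 < x → 0 < y → Cmp D x y → Cmp C (x ^ α * v x) (y ^ α * v y) := by
  obtain ⟨C, hC, H⟩ := hv.cmp_of_cmp D
  -- The absolute value and the summand 1 keep the constant positive for every real D; comparability
  -- of positive points forces D > 0.
  refine ⟨|D| ^ |α| * C + 1, by positivity, fun x y hx hy h => ?_⟩
  have hD := h.const_pos hx hy
  have hvx := hv.pos x hx
  have hvy := hv.pos y hy
  refine ((h.rpow hx hy α).mul (by positivity) (by positivity) hvx hvy (H x y hx hy h)).mono
    (by positivity) (by positivity) ?_
  rw [abs_of_pos hD]
  linarith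

/-- Half of the power absorbs v by a Potter bound; the other half gives the geometric factor,
because x/y ≤ 2^{-n}. -/
theorem Potter.rpow_mul_decay {v : ℝ → ℝ} (hv : Potter v) {α : ℝ} (hα : 0 < α) :
    ∃ C > 0, ∀ (x y : ℝ) (n : ℕ), 0 < x → 2 ^ n * x ≤ y →
      y ^ (-α) * v y ≤ C * ((2 : ℝ) ^ (-(α / 2))) ^ n * (x ^ (-α) * v x) ∧
      x ^ α * v x ≤ C * ((2 : ℝ) ^ (-(α / 2))) ^ n * (y ^ α * v y) := by
  obtain ⟨C, hC, H⟩ := hv.le_of_le (half_pos hα)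
  refine ⟨C, hC, fun x y n hx hxy => ?_⟩
  have h2n : (1 : ℝ) ≤ 2 ^ n := one_le_pow₀ one_le_two
  have hle : x ≤ y := by nlinarith
  have hy := hx.trans_le hle
  have hvx := hv.pos x hx
  have hvy := hv.pos y hy
  obtain ⟨h1, h2⟩ := H x y hx hle
  have hxa : 0 < x ^ (α / 2) := by positivity
  have hya : 0 < y ^ (α / 2) := by positivity
  have hxα : x ^ α = x ^ (α / 2) * x ^ (α / 2) := by rw [← Real.rpow_add hx]; ring_nf
  have hyα : y ^ α = y ^ (α / 2) * y ^ (α / 2) := by rw [← Real.rpow_add hy]; ring_nf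
  have hdecay : x ^ (α / 2) / y ^ (α / 2) ≤ ((2 : ℝ) ^ (-(α / 2))) ^ n := by
    rw [← Real.div_rpow hx.le hy.le, ← Real.rpow_natCast, ← Real.rpow_mul two_pos.le, mul_comm,
      Real.rpow_mul two_pos.le, Real.rpow_natCast, Real.rpow_neg (by positivity),
      ← Real.inv_rpow (by positivity)]
    refine Real.rpow_le_rpow (by positivity) ?_ (by positivity)
    rw [div_le_iff₀ hy, inv_mul_eq_div, le_div_iff₀ (by positivity)]
    linarith
  rw [Real.div_rpow hy.le hx.le] at h1 h2
  constructor
  · rw [Real.rpow_neg hy.le, Real.rpow_neg hx.le]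
    calc (y ^ α)⁻¹ * v y ≤ (y ^ α)⁻¹ * (C * (y ^ (α / 2) / x ^ (α / 2)) * v x) := by gcongr
      _ = C * (x ^ (α / 2) / y ^ (α / 2)) * ((x ^ α)⁻¹ * v x) := by
        rw [hxα, hyα]; field_simp
      _ ≤ _ := by gcongr
  · calc x ^ α * v x ≤ x ^ α * (C * (y ^ (α / 2) / x ^ (α / 2)) * v y) := by gcongr
      _ = C * (x ^ (α / 2) / y ^ (α / 2)) * (y ^ α * v y) := by
        rw [hxα, hyα]; field_simp
      _ ≤ _ := by gcongr

/-- Discretization of the interpolation quasi-norm. -/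
theorem interpNorm_discrete (hq : 0 < q) (hb : Potter b) (hM : 2 ≤ M) {x : ℤ → ℝ}
    (hx : ∀ k, 0 < x k) (hmono : Monotone x) (hlow : ∀ y, 0 < y → ∃ k, x k < y)
    (hup : ∀ y, ∃ k, y ≤ x k) (h2 : ∀ k, 2 * x k ≤ x (k + 1)) (hxM : ∀ k, x (k + 1) ≤ M * x k) :
    ∃ c > 0, ∃ C > 0, ∀ {V : Type*} [AddCommGroup V] (N₀ N₁ : V → ℝ≥0∞) (f : V),
      ENNReal.ofReal c * ∑' k, ENNReal.ofReal (kWeight θ q b (x k)) *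
          kFunctional N₀ N₁ (x k) f ^ q ≤ interpNorm N₀ N₁ θ q b f ^ q ∧
      interpNorm N₀ N₁ θ q b f ^ q ≤ ENNReal.ofReal C *
        ∑' k, ENNReal.ofReal (kWeight θ q b (x k)) * kFunctional N₀ N₁ (x k) f ^ q := by
  have hM0 : 0 < M := by linarith
  obtain ⟨D, hD, H⟩ := (hb.rpow q).rpow_mul_cmp (-(θ * q) - 1) M
  refine ⟨D⁻¹, by positivity, D * M ^ q * M, by positivity, fun {V} _ N₀ N₁ f => ?_⟩
  -- On a block the density m is comparable to its value at x k, and `kWeight` is that value times x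
  -- k. The block length lies between x k and M x k; the K-functional is bounded below by
  -- monotonicity and above by the decrease of K(s)/s.
  set m : ℝ → ℝ := fun s => s ^ (-(θ * q) - 1) * b s ^ q with hm
  have hmpos : ∀ s, 0 < s → 0 < m s := fun s hs =>
    mul_pos (Real.rpow_pos_of_pos hs _) (Real.rpow_pos_of_pos (hb.pos s hs) _)
  have hmw : ∀ k, kWeight θ q b (x k) = m (x k) * x k := fun k => by
    have := hx k
    simp only [hm, kWeight]
    rw [Real.rpow_sub_one this.ne']
    field_simp
  have hnorm : interpNorm N₀ N₁ θ q b f ^ q =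
      ∑' k, ∫⁻ s in Ioc (x k) (x (k + 1)), ENNReal.ofReal (m s) * kFunctional N₀ N₁ s f ^ q := by
    rw [interpNorm, lqNorm, ← ENNReal.rpow_mul, one_div_mul_cancel hq.ne', ENNReal.rpow_one,
      lintegral_Ioi_eq_tsum hmono hx hlow hup]
    congr 1 with k
    refine setLIntegral_congr_fun measurableSet_Ioc fun s hs => ?_
    have hs0 : 0 < s := (hx k).trans hs.1
    have hbs := hb.pos s hs0
    rw [ENNReal.mul_rpow_of_nonneg _ _ hq.le, ENNReal.ofReal_rpow_of_pos (by positivity),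
      Real.mul_rpow (by positivity) hbs.le, ← Real.rpow_mul hs0.le]
    congr 4
    field_simp
  have hcmp : ∀ k, ∀ s ∈ Ioc (x k) (x (k + 1)), Cmp D (m s) (m (x k)) := by
    intro k s hs
    have hs0 : 0 < s := (hx k).trans hs.1
    refine H s (x k) hs0 (hx k) ⟨hs.2.trans (hxM k), ?_⟩
    nlinarith [hs.1]
  rw [hnorm]
  constructor
  · rw [← ENNReal.tsum_mul_left]
    refine ENNReal.tsum_le_tsum fun k => ?_
    have hxk := hx k
    have hmk := hmpos _ hxk
    calc ENNReal.ofReal D⁻¹ * (ENNReal.ofReal (kWeight θ q b (x k)) *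
          kFunctional N₀ N₁ (x k) f ^ q)
        = (ENNReal.ofReal (D⁻¹ * m (x k)) * kFunctional N₀ N₁ (x k) f ^ q) *
            ENNReal.ofReal (x k) := by
          rw [hmw k, ofReal_mul_ofReal_mul (by positivity), ← mul_assoc,
            ENNReal.ofReal_mul (q := x k) (by positivity)]
          ring
      _ ≤ (ENNReal.ofReal (D⁻¹ * m (x k)) * kFunctional N₀ N₁ (x k) f ^ q) *
            ENNReal.ofReal (x (k + 1) - x k) := by
          gcongr
          linarith [h2 k]
      _ = ∫⁻ _ in Ioc (x k) (x (k + 1)), ENNReal.ofReal (D⁻¹ * m (x k)) *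
            kFunctional N₀ N₁ (x k) f ^ q := by rw [setLIntegral_const, Real.volume_Ioc]
      _ ≤ _ := by
          refine setLIntegral_mono' measurableSet_Ioc fun s hs => ?_
          gcongr
          · rw [inv_mul_le_iff₀ hD]
            exact (hcmp k s hs).2
          · exact kFunctional_mono hs.1.le
  · rw [← ENNReal.tsum_mul_left]
    refine ENNReal.tsum_le_tsum fun k => ?_
    have hxk := hx k
    have hmk := hmpos _ hxk
    calc ∫⁻ s in Ioc (x k) (x (k + 1)), ENNReal.ofReal (m s) * kFunctional N₀ N₁ s f ^ q
        ≤ ∫⁻ _ in Ioc (x k) (x (k + 1)), ENNReal.ofReal (D * m (x k)) *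
            (ENNReal.ofReal M * kFunctional N₀ N₁ (x k) f) ^ q := by
          refine setLIntegral_mono' measurableSet_Ioc fun s hs => ?_
          gcongr
          · exact (hcmp k s hs).1
          · refine (kFunctional_le_mul hxk hs.1.le).trans ?_
            gcongr
            rw [div_le_iff₀ hxk]
            exact hs.2.trans (hxM k)
      _ = (ENNReal.ofReal (D * m (x k)) * (ENNReal.ofReal M * kFunctional N₀ N₁ (x k) f) ^ q) *
            ENNReal.ofReal (x (k + 1) - x k) := by rw [setLIntegral_const, Real.volume_Ioc]
      _ ≤ (ENNReal.ofReal (D * m (x k)) * (ENNReal.ofReal M * kFunctional N₀ N₁ (x k) f) ^ q) *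
            ENNReal.ofReal (M * x k) := by
          gcongr
          linarith [hxM k]
      _ = _ := by
          rw [hmw k, ENNReal.mul_rpow_of_nonneg _ _ hq.le, ENNReal.ofReal_rpow_of_pos hM0,
            ofReal_mul_ofReal_mul (by positivity), ofReal_mul_ofReal_mul (by positivity),
            mul_right_comm, ← ENNReal.ofReal_mul (by positivity)]
          congr 2
          ring

end KWeight

/-! ### The weight b̃ along the grid. -/

/-- The discrete weight `ρ(u)^{-θ q} b(ρ(u))^q ‖·‖_{q₀,(u,∞)}^q` of the interpolation space. -/
def jointWeight (q₀ q₁ q θ : ℝ) (b₀ b₁ b : ℝ → ℝ) (u : ℝ) : ℝ :=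
  kWeight θ q b (rho q₀ q₁ b₀ b₁ u) * tailNorm q₀ b₀ u ^ q

section Weights

variable {q₀ q₁ q θ M : ℝ} {b₀ b₁ b : ℝ → ℝ} {t : ℤ → ℝ}

theorem jointWeight_pos (hq₀ : 0 < q₀) (hq₁ : 0 < q₁) (hb₀ : IsSV0 q₀ b₀) (hb₁ : IsSV0 q₁ b₁)
    (hb : Potter b) {u : ℝ} (hu : 0 < u) : 0 < jointWeight q₀ q₁ q θ b₀ b₁ b u :=
  mul_pos (kWeight_pos hb (rho_pos hq₀ hq₁ hb₀ hb₁ hu))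
    (Real.rpow_pos_of_pos (tailNorm_pos hq₀ hb₀ hu) _)

theorem bTilde_pos (hq₀ : 0 < q₀) (hq₁ : 0 < q₁) (hb₀ : IsSV0 q₀ b₀) (hb₁ : IsSV0 q₁ b₁)
    (hb : Potter b) {u : ℝ} (hu : 0 < u) : 0 < bTilde q₀ q₁ q θ b₀ b₁ b u := by
  have hρ := rho_pos hq₀ hq₁ hb₀ hb₁ hu
  have h1 := hb.pos _ hρ
  have h2 := hb₁.isSV.pos u hu
  have h3 := tailNorm_pos hq₁ hb₁ hu
  rw [bTilde, integral_tail_eq hq₁ hb₁ hu]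
  positivity

/-- This factorization explains the form of b̃. The power ρ^{(1-θ)q} splits as ρ^{-θq} ρ^q, the
exponent of a_1 is q - q_1, and ρ^q a_1^q = a_0^q. -/
theorem bTilde_rpow (hq₀ : 0 < q₀) (hq₁ : 0 < q₁) (hq : 0 < q) (hb₀ : IsSV0 q₀ b₀)
    (hb₁ : IsSV0 q₁ b₁) (hb : Potter b) {u : ℝ} (hu : 0 < u) :
    bTilde q₀ q₁ q θ b₀ b₁ b u ^ q =
      jointWeight q₀ q₁ q θ b₀ b₁ b u * tailNorm q₁ b₁ u ^ (-q₁) * b₁ u ^ q₁ := by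
  have hρ := rho_pos hq₀ hq₁ hb₀ hb₁ hu
  have h1 := hb.pos _ hρ
  have h2 := hb₁.isSV.pos u hu
  have h3 := tailNorm_pos hq₁ hb₁ hu
  rw [bTilde, integral_tail_eq hq₁ hb₁ hu, jointWeight, kWeight,
    tailNorm_eq_rho_mul (b₀ := b₀) (q₀ := q₀) hq₁ hb₁ hu]
  set R := rho q₀ q₁ b₀ b₁ u
  set A := tailNorm q₁ b₁ u
  rw [Real.mul_rpow (by positivity) (by positivity), Real.mul_rpow (by positivity) (by positivity),
    Real.mul_rpow (by positivity) (by positivity), Real.mul_rpow hρ.le h3.le,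
    ← Real.rpow_mul hρ.le, ← Real.rpow_mul h2.le, ← Real.rpow_mul h3.le, ← Real.rpow_mul h3.le,
    div_mul_cancel₀ _ hq.ne']
  have e1 : R ^ ((1 - θ) * q) = R ^ (-(θ * q)) * R ^ q := by
    rw [← Real.rpow_add hρ]; ring_nf
  have e2 : A ^ (q₁ * (1 / q₁ - 1 / q) * q) = A ^ q * A ^ (-q₁) := by
    rw [← Real.rpow_add h3]
    congr 1
    field_simp
    ring
  rw [e1, e2]
  ring

/-- On a block of the grid the weights are essentially constant. -/
theorem weights_cmp (hq₀ : 0 < q₀) (hq₁ : 0 < q₁) (hb₀ : IsSV0 q₀ b₀)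
    (hb₁ : IsSV0 q₁ b₁) (hb : Potter b) (hmono : MonotoneOn (rho q₀ q₁ b₀ b₁) (Ioi 0))
    (ht : IsGrid q₀ q₁ b₀ b₁ M t) :
    ∃ D > 0, ∀ k, ∀ u ∈ Icc (t k) (t (k + 1)),
      Cmp D (jointWeight q₀ q₁ q θ b₀ b₁ b u) (jointWeight q₀ q₁ q θ b₀ b₁ b (t k)) ∧
      Cmp D (jointWeight q₀ q₁ q θ b₀ b₁ b u * tailNorm q₁ b₁ u ^ (-q₁))
        (jointWeight q₀ q₁ q θ b₀ b₁ b (t k) * tailNorm q₁ b₁ (t k) ^ (-q₁)) := by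
  have hM2 := ht.two_le
  have hM1 : 1 ≤ M := by linarith
  have hM0 : 0 < M := by linarith
  obtain ⟨C, hC, H⟩ := (hb.rpow q).rpow_mul_cmp (-(θ * q)) M
  refine ⟨max (C * M ^ |q|) (C * M ^ |q| * M ^ |(-q₁)|), by positivity, fun k u hu => ?_⟩
  have hk := ht.pos k
  have hk1 := ht.pos (k + 1)
  have hu0 : 0 < u := hk.trans_le hu.1
  have hρu := rho_pos hq₀ hq₁ hb₀ hb₁ hu0
  have hρk := rho_pos hq₀ hq₁ hb₀ hb₁ hk
  -- Between grid points ρ is controlled by its monotonicity, and the two tail norms below by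
  -- theirs.
  have hcρ : Cmp M (rho q₀ q₁ b₀ b₁ u) (rho q₀ q₁ b₀ b₁ (t k)) := by
    refine ⟨(hmono hu0 hk1 hu.2).trans (ht.le_mul k), ?_⟩
    have := hmono hk hu0 hu.1
    nlinarith
  have ha0 := tailNorm_pos hq₀ hb₀ hu0
  have ha0k := tailNorm_pos hq₀ hb₀ hk
  have hca0 : Cmp M (tailNorm q₀ b₀ u) (tailNorm q₀ b₀ (t k)) := by
    have h1 := tailNorm_anti hq₀ hb₀ hk hu.1
    have h2 := tailNorm_anti hq₀ hb₀ hu0 hu.2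
    refine ⟨by nlinarith, (ht.tailNorm_le hq₀ hq₁ hb₀ hb₁ k).trans (by gcongr)⟩
  have ha1 := tailNorm_pos hq₁ hb₁ hu0
  have ha1k := tailNorm_pos hq₁ hb₁ hk
  have hca1 : Cmp M (tailNorm q₁ b₁ u) (tailNorm q₁ b₁ (t k)) := by
    have h1 := tailNorm_anti hq₁ hb₁ hk hu.1
    have h2 := tailNorm_anti hq₁ hb₁ hu0 hu.2
    refine ⟨by nlinarith, (ht.tail_eq k).le.trans (by gcongr)⟩
  have hW := jointWeight_pos (q := q) (θ := θ) hq₀ hq₁ hb₀ hb₁ hb hu0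
  have hWk := jointWeight_pos (q := q) (θ := θ) hq₀ hq₁ hb₀ hb₁ hb hk
  have hcW : Cmp (C * M ^ |q|) (jointWeight q₀ q₁ q θ b₀ b₁ b u)
      (jointWeight q₀ q₁ q θ b₀ b₁ b (t k)) :=
    (H _ _ hρu hρk hcρ).mul (kWeight_pos hb hρu) (kWeight_pos hb hρk)
      (by positivity) (by positivity) (hca0.rpow ha0 ha0k q)
  exact ⟨hcW.mono hW hWk (le_max_left _ _),
    (hcW.mul hW hWk (by positivity) (by positivity) (hca1.rpow ha1 ha1k (-q₁))).mono
      (by positivity) (by positivity) (le_max_right _ _)⟩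

/-- Discretization of one block of the gamma quasi-norm with weight `b̃`. -/
theorem bTilde_block (hq₀ : 0 < q₀) (hq₁ : 0 < q₁) (hq : 0 < q) (hb₀ : IsSV0 q₀ b₀)
    (hb₁ : IsSV0 q₁ b₁) (hb : Potter b) (hmono : MonotoneOn (rho q₀ q₁ b₀ b₁) (Ioi 0))
    (ht : IsGrid q₀ q₁ b₀ b₁ M t) :
    ∃ c > 0, ∃ C > 0, ∀ (F : ℝ → ℝ≥0∞), Monotone F → ∀ k,
      ENNReal.ofReal c * (ENNReal.ofReal (jointWeight q₀ q₁ q θ b₀ b₁ b (t k)) * F (t k) ^ q) ≤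
        ∫⁻ u in Ioc (t k) (t (k + 1)),
          ENNReal.ofReal (bTilde q₀ q₁ q θ b₀ b₁ b u ^ q / u) * F u ^ q ∧
      ∫⁻ u in Ioc (t k) (t (k + 1)),
          ENNReal.ofReal (bTilde q₀ q₁ q θ b₀ b₁ b u ^ q / u) * F u ^ q ≤
        ENNReal.ofReal C *
          (ENNReal.ofReal (jointWeight q₀ q₁ q θ b₀ b₁ b (t k)) * F (t (k + 1)) ^ q) := by
  obtain ⟨D, hD, H⟩ := weights_cmp (q := q) (θ := θ) hq₀ hq₁ hb₀ hb₁ hb hmono ht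
  have hM1 : 1 < M := by linarith [ht.two_le]
  set e : ℝ := 1 - (M ^ q₁)⁻¹ with he
  have he0 : 0 < e := by
    have : (M ^ q₁)⁻¹ < 1 := inv_lt_one_of_one_lt₀ (Real.one_lt_rpow hM1 hq₁)
    linarith
  refine ⟨D⁻¹ * e, by positivity, D * e, by positivity, fun F hF k => ?_⟩
  have hk := ht.pos k
  have hWk := jointWeight_pos (q := q) (θ := θ) hq₀ hq₁ hb₀ hb₁ hb hk
  have ha1k := tailNorm_pos hq₁ hb₁ hk
  set W := jointWeight q₀ q₁ q θ b₀ b₁ b with hWdef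
  -- The value at t k of the nearly constant factor of b̃^q; what remains to integrate is b₁^{q₁}
  -- du/u, whose block mass is known exactly.
  set g := W (t k) * tailNorm q₁ b₁ (t k) ^ (-q₁) with hg
  have hg0 : 0 < g := by positivity
  have hgW : g * tailNorm q₁ b₁ (t k) ^ q₁ = W (t k) := by
    rw [hg, mul_assoc, ← Real.rpow_add ha1k, neg_add_cancel, Real.rpow_zero, mul_one]
  have hmass := ht.lintegral_block hq₁ hb₁ k
  rw [← he] at hmass
  have hint : ∀ u ∈ Ioc (t k) (t (k + 1)),
      D⁻¹ * g * (b₁ u ^ q₁ / u) ≤ bTilde q₀ q₁ q θ b₀ b₁ b u ^ q / u ∧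
      bTilde q₀ q₁ q θ b₀ b₁ b u ^ q / u ≤ D * g * (b₁ u ^ q₁ / u) := by
    intro u hu
    have hu0 : 0 < u := hk.trans hu.1
    have hb1 := hb₁.isSV.pos u hu0
    obtain ⟨h1, h2⟩ := (H k u ⟨hu.1.le, hu.2⟩).2
    rw [bTilde_rpow hq₀ hq₁ hq hb₀ hb₁ hb hu0, mul_div_assoc]
    constructor
    · refine mul_le_mul_of_nonneg_right ?_ (by positivity)
      rw [inv_mul_le_iff₀ hD]
      exact h2
    · exact mul_le_mul_of_nonneg_right h1 (by positivity)
  constructor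
  · calc ENNReal.ofReal (D⁻¹ * e) * (ENNReal.ofReal (W (t k)) * F (t k) ^ q)
        = ENNReal.ofReal (D⁻¹ * g) * ((∫⁻ u in Ioc (t k) (t (k + 1)),
            ENNReal.ofReal (b₁ u ^ q₁ / u)) * F (t k) ^ q) := by
          rw [hmass, ofReal_mul_ofReal_mul (by positivity), ofReal_mul_ofReal_mul (by positivity),
            ← hgW]
          congr 2
          ring
      _ ≤ ENNReal.ofReal (D⁻¹ * g) * ∫⁻ u in Ioc (t k) (t (k + 1)),
            ENNReal.ofReal (b₁ u ^ q₁ / u) * F (t k) ^ q := by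
          gcongr
          exact lintegral_mul_const_le _ _
      _ = ∫⁻ u in Ioc (t k) (t (k + 1)), ENNReal.ofReal (D⁻¹ * g) *
            (ENNReal.ofReal (b₁ u ^ q₁ / u) * F (t k) ^ q) := by
          rw [lintegral_const_mul' _ _ ENNReal.ofReal_ne_top]
      _ ≤ _ := by
          refine setLIntegral_mono' measurableSet_Ioc fun u hu => ?_
          rw [ofReal_mul_ofReal_mul (by positivity)]
          gcongr
          · exact (hint u hu).1
          · exact hF hu.1.le
  · by_cases htop : F (t (k + 1)) ^ q = ∞
    · rw [htop, ENNReal.mul_top (ENNReal.ofReal_pos.2 hWk).ne',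
        ENNReal.mul_top (ENNReal.ofReal_pos.2 (by positivity)).ne']
      exact le_top
    calc ∫⁻ u in Ioc (t k) (t (k + 1)),
          ENNReal.ofReal (bTilde q₀ q₁ q θ b₀ b₁ b u ^ q / u) * F u ^ q
        ≤ ∫⁻ u in Ioc (t k) (t (k + 1)), ENNReal.ofReal (D * g) *
            (ENNReal.ofReal (b₁ u ^ q₁ / u) * F (t (k + 1)) ^ q) := by
          refine setLIntegral_mono' measurableSet_Ioc fun u hu => ?_
          rw [ofReal_mul_ofReal_mul (by positivity)]
          gcongr
          · exact (hint u hu).2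
          · exact hF hu.2
      _ = _ := by
          rw [lintegral_const_mul' _ _ ENNReal.ofReal_ne_top, lintegral_mul_const' _ _ htop, hmass,
            ofReal_mul_ofReal_mul (by positivity), ofReal_mul_ofReal_mul (by positivity), ← hgW]
          congr 2
          ring

/-- Shifting the argument in the discrete quasi-norm. -/
theorem tsum_shift_le (hq₀ : 0 < q₀) (hq₁ : 0 < q₁) (hb₀ : IsSV0 q₀ b₀)
    (hb₁ : IsSV0 q₁ b₁) (hb : Potter b) (hmono : MonotoneOn (rho q₀ q₁ b₀ b₁) (Ioi 0))
    (ht : IsGrid q₀ q₁ b₀ b₁ M t) :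
    ∃ C > 0, ∀ F : ℝ → ℝ≥0∞,
      ∑' k, ENNReal.ofReal (jointWeight q₀ q₁ q θ b₀ b₁ b (t k)) * F (t (k + 1)) ^ q ≤
        ENNReal.ofReal C *
          ∑' k, ENNReal.ofReal (jointWeight q₀ q₁ q θ b₀ b₁ b (t k)) * F (t k) ^ q := by
  obtain ⟨D, hD, H⟩ := weights_cmp (q := q) (θ := θ) hq₀ hq₁ hb₀ hb₁ hb hmono ht
  refine ⟨D, hD, fun F => ?_⟩
  set W := jointWeight q₀ q₁ q θ b₀ b₁ b with hWdef
  calc ∑' k, ENNReal.ofReal (W (t k)) * F (t (k + 1)) ^ q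
      ≤ ∑' k, ENNReal.ofReal D * (ENNReal.ofReal (W (t (k + 1))) * F (t (k + 1)) ^ q) := by
        refine ENNReal.tsum_le_tsum fun k => ?_
        rw [ofReal_mul_ofReal_mul hD.le]
        gcongr
        exact (H k (t (k + 1)) ⟨ht.mono (by omega), le_rfl⟩).1.2
    _ = _ := by
        rw [ENNReal.tsum_mul_left]
        congr 1
        exact (Equiv.addRight (1 : ℤ)).tsum_eq fun k => ENNReal.ofReal (W (t k)) * F (t k) ^ q

/-- Discretization of the gamma quasi-norm with weight `b̃`. -/
theorem bTilde_discrete (hq₀ : 0 < q₀) (hq₁ : 0 < q₁) (hq : 0 < q) (hb₀ : IsSV0 q₀ b₀)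
    (hb₁ : IsSV0 q₁ b₁) (hb : Potter b) (hmono : MonotoneOn (rho q₀ q₁ b₀ b₁) (Ioi 0))
    (ht : IsGrid q₀ q₁ b₀ b₁ M t) :
    ∃ c > 0, ∃ C > 0, ∀ (F : ℝ → ℝ≥0∞), Monotone F →
      ENNReal.ofReal c *
          ∑' k, ENNReal.ofReal (jointWeight q₀ q₁ q θ b₀ b₁ b (t k)) * F (t k) ^ q ≤
        ∫⁻ u in Ioi 0, ENNReal.ofReal (bTilde q₀ q₁ q θ b₀ b₁ b u ^ q / u) * F u ^ q ∧
      ∫⁻ u in Ioi 0, ENNReal.ofReal (bTilde q₀ q₁ q θ b₀ b₁ b u ^ q / u) * F u ^ q ≤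
        ENNReal.ofReal C *
          ∑' k, ENNReal.ofReal (jointWeight q₀ q₁ q θ b₀ b₁ b (t k)) * F (t k) ^ q := by
  obtain ⟨c, hc, C, hC, H⟩ := bTilde_block (θ := θ) hq₀ hq₁ hq hb₀ hb₁ hb hmono ht
  obtain ⟨D, hD, HD⟩ := tsum_shift_le (q := q) (θ := θ) hq₀ hq₁ hb₀ hb₁ hb hmono ht
  refine ⟨c, hc, C * D, by positivity, fun F hF => ?_⟩
  rw [lintegral_Ioi_eq_tsum ht.mono ht.pos ht.low ht.up, ENNReal.ofReal_mul hC.le, mul_assoc]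
  constructor
  · rw [← ENNReal.tsum_mul_left]
    exact ENNReal.tsum_le_tsum fun k => (H F hF k).1
  · refine (ENNReal.tsum_le_tsum fun k => (H F hF k).2).trans ?_
    rw [ENNReal.tsum_mul_left]
    gcongr
    exact HD F

/-- Geometric behaviour of the weights along the grid. -/
theorem kWeight_decay (hq : 0 < q) (hθ₀ : 0 < θ) (hq₀ : 0 < q₀) (hq₁ : 0 < q₁)
    (hb₀ : IsSV0 q₀ b₀) (hb₁ : IsSV0 q₁ b₁) (hb : Potter b) (ht : IsGrid q₀ q₁ b₀ b₁ M t) :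
    ∃ C > 0, ∃ γ > 0, γ < 1 ∧ ∀ (k : ℤ) (n : ℕ),
      kWeight θ q b (rho q₀ q₁ b₀ b₁ (t (k + n))) ≤
        C * γ ^ n * kWeight θ q b (rho q₀ q₁ b₀ b₁ (t k)) := by
  obtain ⟨C, hC, H⟩ := (hb.rpow q).rpow_mul_decay (mul_pos hθ₀ hq)
  refine ⟨C, hC, _, by positivity, Real.rpow_lt_one_of_one_lt_of_neg one_lt_two ?_, fun k n =>
    (H _ _ n (rho_pos hq₀ hq₁ hb₀ hb₁ (ht.pos k)) (ht.pow_mul_le k n)).1⟩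
  have := mul_pos hθ₀ hq
  linarith

/-- Multiplication by ρ^q changes the exponent -θq into (1-θ)q, which is positive since θ < 1. -/
theorem kWeight_growth (hq : 0 < q) (hθ₁ : θ < 1) (hq₀ : 0 < q₀) (hq₁ : 0 < q₁)
    (hb₀ : IsSV0 q₀ b₀) (hb₁ : IsSV0 q₁ b₁) (hb : Potter b) (ht : IsGrid q₀ q₁ b₀ b₁ M t) :
    ∃ C > 0, ∃ γ > 0, γ < 1 ∧ ∀ (k : ℤ) (n : ℕ),
      kWeight θ q b (rho q₀ q₁ b₀ b₁ (t k)) * rho q₀ q₁ b₀ b₁ (t k) ^ q ≤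
        C * γ ^ n * (kWeight θ q b (rho q₀ q₁ b₀ b₁ (t (k + n))) *
          rho q₀ q₁ b₀ b₁ (t (k + n)) ^ q) := by
  have hpos : 0 < (1 - θ) * q := mul_pos (by linarith) hq
  obtain ⟨C, hC, H⟩ := (hb.rpow q).rpow_mul_decay hpos
  refine ⟨C, hC, 2 ^ (-((1 - θ) * q / 2)), by positivity,
    Real.rpow_lt_one_of_one_lt_of_neg one_lt_two ?_, fun k n => ?_⟩
  · linarith
  · have hk := rho_pos hq₀ hq₁ hb₀ hb₁ (ht.pos k)
    have hid : ∀ s, 0 < s → kWeight θ q b s * s ^ q = s ^ ((1 - θ) * q) * b s ^ q := by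
      intro s hs
      have : s ^ ((1 - θ) * q) = s ^ (-(θ * q)) * s ^ q := by
        rw [← Real.rpow_add hs]; ring_nf
      rw [kWeight, this]
      ring
    rw [hid _ hk, hid _ (rho_pos hq₀ hq₁ hb₀ hb₁ (ht.pos _))]
    exact (H _ _ n hk (ht.pow_mul_le k n)).2

theorem Potter.congr {v v' : ℝ → ℝ} (hv : Potter v) (h : ∀ t, 0 < t → v' t = v t) : Potter v' := by
  refine ⟨fun t ht => by rw [h t ht]; exact hv.pos t ht, fun ε hε => ?_⟩
  obtain ⟨C, hC, H⟩ := hv.cmp ε hε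
  refine ⟨C, hC, fun D x y hx hy hD => ?_⟩
  rw [h x hx, h y hy]
  exact H D x y hx hy hD

theorem potter_rho (hq₀ : 0 < q₀) (hq₁ : 0 < q₁) (hb₀ : IsSV0 q₀ b₀) (hb₁ : IsSV0 q₁ b₁) :
    Potter (rho q₀ q₁ b₀ b₁) :=
  ((potter_tailNorm hq₀ hb₀).mul ((potter_tailNorm hq₁ hb₁).rpow (-1))).congr fun t _ => by
    rw [rho, Real.rpow_neg_one, div_eq_mul_inv]

theorem potter_bTilde (hq₀ : 0 < q₀) (hq₁ : 0 < q₁) (hb₀ : IsSV0 q₀ b₀) (hb₁ : IsSV0 q₁ b₁)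
    (hb : Potter b) : Potter (bTilde q₀ q₁ q θ b₀ b₁ b) := by
  have hρ := potter_rho hq₀ hq₁ hb₀ hb₁
  refine (((hρ.rpow (1 - θ)).mul (hb.comp hρ)).mul (hb₁.isSV.potter.rpow (q₁ / q))).mul
    (((potter_tailNorm hq₁ hb₁).rpow q₁).rpow (1 / q₁ - 1 / q)) |>.congr fun t ht => ?_
  rw [bTilde, integral_tail_eq hq₁ hb₁ ht]

/-- Slow variation comes from the closure properties of Potter bounds. The tail is finite because
its block integrals are controlled by `jointWeight` at the grid points, where `kWeight` decays
geometrically (θ > 0) and a_0 does not increase. -/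
theorem isSV0_bTilde (hq₀ : 0 < q₀) (hq₁ : 0 < q₁) (hq : 0 < q) (hθ₀ : 0 < θ)
    (hb₀ : IsSV0 q₀ b₀) (hb₁ : IsSV0 q₁ b₁) (hb : Potter b)
    (hmono : MonotoneOn (rho q₀ q₁ b₀ b₁) (Ioi 0)) (ht : IsGrid q₀ q₁ b₀ b₁ M t)
    (hm : AEMeasurable (fun u => b (rho q₀ q₁ b₀ b₁ u)) (volume.restrict (Ioi 0))) :
    IsSV0 q (bTilde q₀ q₁ q θ b₀ b₁ b) := by
  have hP := potter_bTilde (q := q) (θ := θ) hq₀ hq₁ hb₀ hb₁ hb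
  have hmeas : AEMeasurable (bTilde q₀ q₁ q θ b₀ b₁ b) (volume.restrict (Ioi 0)) := by
    have h1 := aemeasurable_restrict_of_monotoneOn (μ := volume) measurableSet_Ioi hmono
    have h2 : AEMeasurable (fun u => ∫ x in Ioi u, b₁ x ^ q₁ / x) (volume.restrict (Ioi 0)) := by
      refine aemeasurable_restrict_of_antitoneOn (μ := volume) measurableSet_Ioi
        fun x hx y hy hxy => ?_
      have := tailNorm_pos hq₁ hb₁ hy
      rw [integral_tail_eq hq₁ hb₁ hx, integral_tail_eq hq₁ hb₁ hy]
      exact Real.rpow_le_rpow this.le (tailNorm_anti hq₁ hb₁ hx hxy) hq₁.le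
    exact (((h1.pow_const _).mul hm).mul (hb₁.isSV.aemeasurable.pow_const _)).mul
      (h2.pow_const _)
  refine ⟨hP.isSV hmeas, ?_⟩
  rw [tailENorm_eq hq hP.pos zero_le_one]
  refine ENNReal.rpow_lt_top_of_nonneg (by positivity) (ne_of_lt ?_)
  obtain ⟨c, hc, C, hC, H⟩ := bTilde_block (θ := θ) hq₀ hq₁ hq hb₀ hb₁ hb hmono ht
  obtain ⟨C', hC', γ, hγ0, hγ1, hV⟩ := kWeight_decay (θ := θ) hq hθ₀ hq₀ hq₁ hb₀ hb₁ hb ht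
  obtain ⟨k, hk⟩ := ht.low 1 one_pos
  have hWk := jointWeight_pos (q := q) (θ := θ) hq₀ hq₁ hb₀ hb₁ hb (ht.pos k)
  calc tailMass q (bTilde q₀ q₁ q θ b₀ b₁ b) 1
      ≤ tailMass q (bTilde q₀ q₁ q θ b₀ b₁ b) (t k) := tailMass_anti hk.le
    _ ≤ ∑' n : ℕ, ∫⁻ u in Ioc (t (k + 1 * n)) (t (k + 1 * n + 1)),
          ENNReal.ofReal (bTilde q₀ q₁ q θ b₀ b₁ b u ^ q / u) :=
        lintegral_Ioi_le_tsum ht.mono ht.pos ht.low ht.up _ k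
    _ ≤ ∑' n : ℕ, ENNReal.ofReal (C * C' * jointWeight q₀ q₁ q θ b₀ b₁ b (t k)) *
          ENNReal.ofReal (γ ^ n) := by
        refine ENNReal.tsum_le_tsum fun n => ?_
        -- With the constant function 1 the block estimate becomes a bound for the mass of b̃^q
        -- du/u.
        have h1 := (H (fun _ => 1) monotone_const (k + 1 * n)).2
        simp only [ENNReal.one_rpow, mul_one] at h1
        refine h1.trans ?_
        rw [← ENNReal.ofReal_mul hC.le, ← ENNReal.ofReal_mul (by positivity), one_mul]
        refine ENNReal.ofReal_le_ofReal ?_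
        have h2 := hV k n
        have h3 := tailNorm_anti hq₀ hb₀ (ht.pos k) (ht.mono (show k ≤ k + n by omega))
        have h4 := tailNorm_pos hq₀ hb₀ (ht.pos (k + n))
        have h5 := kWeight_pos (θ := θ) (q := q) hb (rho_pos hq₀ hq₁ hb₀ hb₁ (ht.pos k))
        rw [jointWeight, jointWeight]
        calc _ ≤ C * (C' * γ ^ n * kWeight θ q b (rho q₀ q₁ b₀ b₁ (t k)) *
              tailNorm q₀ b₀ (t k) ^ q) := by gcongr
          _ = _ := by ring
    _ < ∞ := by
        rw [ENNReal.tsum_mul_left, tsum_ofReal_geometric hγ0.le hγ1]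
        exact ENNReal.mul_lt_top ENNReal.ofReal_lt_top ENNReal.ofReal_lt_top

end Weights

/-! ### Hardy estimates and equivalence of the norms. -/

section Main

variable {q₀ q₁ q θ M : ℝ} {b₀ b₁ b : ℝ → ℝ} {t : ℤ → ℝ}

theorem lintegral_Ioc_le_tailNorm (hq : 0 < q) (hb : IsSV0 q b) {F : ℝ → ℝ≥0∞} (hF : Monotone F)
    {x y : ℝ} (hx : 0 < x) :
    ∫⁻ u in Ioc x y, ENNReal.ofReal (b u ^ q / u) * F u ^ q ≤
      ENNReal.ofReal (tailNorm q b x ^ q) * F y ^ q := by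
  have h0 := tailNorm_pos hq hb hx
  by_cases htop : F y ^ q = ∞
  · rw [htop, ENNReal.mul_top (ENNReal.ofReal_pos.2 (by positivity)).ne']
    exact le_top
  calc _ ≤ ∫⁻ u in Ioc x y, ENNReal.ofReal (b u ^ q / u) * F y ^ q := by
        refine setLIntegral_mono' measurableSet_Ioc fun u hu => ?_
        gcongr
        exact hF hu.2
    _ = (∫⁻ u in Ioc x y, ENNReal.ofReal (b u ^ q / u)) * F y ^ q := lintegral_mul_const' _ _ htop
    _ ≤ _ := by
        rw [ofReal_tailNorm_rpow hq hb hx]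
        gcongr
        exact lintegral_mono_set Ioc_subset_Ioi_self

theorem ofReal_mul_rpow_rpow (hq : 0 ≤ q) {x a : ℝ} (hx : 0 < x) (ha : 0 < a) (y : ℝ≥0∞) :
    (ENNReal.ofReal (x ^ a) * y ^ a) ^ (q / a) = ENNReal.ofReal (x ^ q) * y ^ q := by
  rw [← ENNReal.ofReal_rpow_of_pos hx, ← ENNReal.mul_rpow_of_nonneg _ _ ha.le, ← ENNReal.rpow_mul,
    mul_div_cancel₀ _ ha.ne', ← ENNReal.ofReal_rpow_of_pos hx, ENNReal.mul_rpow_of_nonneg _ _ hq]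

/-- The integral over (0, t k] is a sum over earlier blocks, so Hardy's inequality is applied with
step -1 and exponent q/q₀, using the decay of `kWeight` as k increases. -/
theorem tsum_lower_le (hq₀ : 0 < q₀) (hq₁ : 0 < q₁) (hq : 0 < q) (hθ₀ : 0 < θ)
    (hb₀ : IsSV0 q₀ b₀) (hb₁ : IsSV0 q₁ b₁) (hb : Potter b) (ht : IsGrid q₀ q₁ b₀ b₁ M t) :
    ∃ C > 0, ∀ F : ℝ → ℝ≥0∞, Monotone F →
      ∑' k, ENNReal.ofReal (kWeight θ q b (rho q₀ q₁ b₀ b₁ (t k))) *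
        (∫⁻ u in Ioc 0 (t k), ENNReal.ofReal (b₀ u ^ q₀ / u) * F u ^ q₀) ^ (q / q₀) ≤
      ENNReal.ofReal C *
        ∑' k, ENNReal.ofReal (jointWeight q₀ q₁ q θ b₀ b₁ b (t k)) * F (t k) ^ q := by
  have hM0 : 0 < M := by linarith [ht.two_le]
  obtain ⟨C, hC, γ, hγ0, hγ1, hV⟩ := kWeight_decay (θ := θ) hq hθ₀ hq₀ hq₁ hb₀ hb₁ hb ht
  obtain ⟨K, hK, HK⟩ := tsum_hardy (div_pos hq hq₀) hγ0 hγ1 hC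
  refine ⟨K * M ^ q, by positivity, fun F hF => ?_⟩
  -- The block ending at t j is bounded through a_0 at its left end; the factor M moves this to t j,
  -- so that both factors sit at the same point.
  set y : ℤ → ℝ≥0∞ := fun j => ENNReal.ofReal ((M * tailNorm q₀ b₀ (t j)) ^ q₀) * F (t j) ^ q₀
    with hy
  calc _ ≤ ∑' k, ENNReal.ofReal (kWeight θ q b (rho q₀ q₁ b₀ b₁ (t k))) *
        (∑' n : ℕ, y (k + (-1) * n)) ^ (q / q₀) := by
        gcongr with k
        refine (lintegral_Ioc_zero_le_tsum ht.mono ht.low ht.up _ k).trans ?_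
        refine ENNReal.tsum_le_tsum fun n => ?_
        refine (lintegral_Ioc_le_tailNorm hq₀ hb₀ hF (ht.pos _)).trans ?_
        have h1 := ht.tailNorm_le hq₀ hq₁ hb₀ hb₁ (k + (-1) * n - 1)
        have h2 := tailNorm_pos hq₀ hb₀ (ht.pos (k + (-1) * n - 1))
        rw [sub_add_cancel] at h1
        simp only [hy]
        gcongr
    _ ≤ ENNReal.ofReal K * ∑' k, ENNReal.ofReal (kWeight θ q b (rho q₀ q₁ b₀ b₁ (t k))) *
          y k ^ (q / q₀) := by
        refine HK _ y (-1) fun k n => ?_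
        rw [← ENNReal.ofReal_mul (by positivity)]
        refine ENNReal.ofReal_le_ofReal ?_
        have := hV (k + (-1) * n) n
        have e : k + (-1) * (n : ℤ) + n = k := by ring
        rwa [e] at this
    _ = _ := by
        rw [ENNReal.ofReal_mul hK.le, mul_assoc,
          ← ENNReal.tsum_mul_left (a := ENNReal.ofReal (M ^ q))]
        congr 2 with k
        have h2 := tailNorm_pos hq₀ hb₀ (ht.pos k)
        have h5 := kWeight_pos (θ := θ) (q := q) hb (rho_pos hq₀ hq₁ hb₀ hb₁ (ht.pos k))
        simp only [hy]
        rw [ofReal_mul_rpow_rpow hq.le (by positivity) hq₀, ofReal_mul_ofReal_mul (by positivity),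
          ofReal_mul_ofReal_mul (by positivity), Real.mul_rpow hM0.le h2.le, jointWeight]
        congr 2
        ring

/-- The mirror case: later blocks, step 1, exponent q/q₁ and the growth of V_k ρ(t_k)^q. Evaluating
F at the right end of a block costs a shift of the index, undone by `tsum_shift_le`; the identity ρ
a_1 = a_0 restores `jointWeight`. -/
theorem tsum_upper_le (hq₀ : 0 < q₀) (hq₁ : 0 < q₁) (hq : 0 < q) (hθ₁ : θ < 1)
    (hb₀ : IsSV0 q₀ b₀) (hb₁ : IsSV0 q₁ b₁) (hb : Potter b)
    (hmono : MonotoneOn (rho q₀ q₁ b₀ b₁) (Ioi 0)) (ht : IsGrid q₀ q₁ b₀ b₁ M t) :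
    ∃ C > 0, ∀ F : ℝ → ℝ≥0∞, Monotone F →
      ∑' k, ENNReal.ofReal (kWeight θ q b (rho q₀ q₁ b₀ b₁ (t k)) * rho q₀ q₁ b₀ b₁ (t k) ^ q) *
        (∫⁻ u in Ioi (t k), ENNReal.ofReal (b₁ u ^ q₁ / u) * F u ^ q₁) ^ (q / q₁) ≤
      ENNReal.ofReal C *
        ∑' k, ENNReal.ofReal (jointWeight q₀ q₁ q θ b₀ b₁ b (t k)) * F (t k) ^ q := by
  obtain ⟨C, hC, γ, hγ0, hγ1, hV⟩ := kWeight_growth (θ := θ) hq hθ₁ hq₀ hq₁ hb₀ hb₁ hb ht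
  obtain ⟨K, hK, HK⟩ := tsum_hardy (div_pos hq hq₁) hγ0 hγ1 hC
  obtain ⟨D, hD, HD⟩ := tsum_shift_le (q := q) (θ := θ) hq₀ hq₁ hb₀ hb₁ hb hmono ht
  refine ⟨K * D, by positivity, fun F hF => ?_⟩
  set y : ℤ → ℝ≥0∞ := fun j => ENNReal.ofReal (tailNorm q₁ b₁ (t j) ^ q₁) * F (t (j + 1)) ^ q₁
    with hy
  calc _ ≤ ∑' k, ENNReal.ofReal (kWeight θ q b (rho q₀ q₁ b₀ b₁ (t k)) *
          rho q₀ q₁ b₀ b₁ (t k) ^ q) * (∑' n : ℕ, y (k + 1 * n)) ^ (q / q₁) := by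
        gcongr with k
        refine (lintegral_Ioi_le_tsum ht.mono ht.pos ht.low ht.up _ k).trans ?_
        exact ENNReal.tsum_le_tsum fun n => lintegral_Ioc_le_tailNorm hq₁ hb₁ hF (ht.pos _)
    _ ≤ ENNReal.ofReal K * ∑' k, ENNReal.ofReal (kWeight θ q b (rho q₀ q₁ b₀ b₁ (t k)) *
          rho q₀ q₁ b₀ b₁ (t k) ^ q) * y k ^ (q / q₁) := by
        refine HK _ y 1 fun k n => ?_
        rw [← ENNReal.ofReal_mul (by positivity), one_mul]
        exact ENNReal.ofReal_le_ofReal (hV k n)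
    _ = ENNReal.ofReal K * ∑' k, ENNReal.ofReal (jointWeight q₀ q₁ q θ b₀ b₁ b (t k)) *
          F (t (k + 1)) ^ q := by
        congr 2 with k
        have h2 := tailNorm_pos hq₁ hb₁ (ht.pos k)
        have h3 := rho_pos hq₀ hq₁ hb₀ hb₁ (ht.pos k)
        have h5 := kWeight_pos (θ := θ) (q := q) hb h3
        simp only [hy]
        rw [ofReal_mul_rpow_rpow hq.le h2 hq₁, ofReal_mul_ofReal_mul (by positivity), jointWeight,
          tailNorm_eq_rho_mul (q₀ := q₀) (b₀ := b₀) hq₁ hb₁ (ht.pos k),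
          Real.mul_rpow h3.le h2.le, mul_assoc]
    _ ≤ _ := by
        rw [ENNReal.ofReal_mul hK.le, mul_assoc]
        gcongr
        exact HD F

theorem le_ofReal_mul_of_rpow_le (hq : 0 < q) {C : ℝ} (hC : 0 < C) {x y : ℝ≥0∞}
    (h : x ^ q ≤ ENNReal.ofReal C * y ^ q) : x ≤ ENNReal.ofReal (C ^ (1 / q)) * y := by
  rw [← ENNReal.rpow_le_rpow_iff hq, ENNReal.mul_rpow_of_nonneg _ _ hq.le,
    ENNReal.ofReal_rpow_of_pos (by positivity), ← Real.rpow_mul hC.le, one_div_mul_cancel hq.ne',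
    Real.rpow_one]
  exact h

variable {Ω : Type*} [MeasurableSpace Ω] {μ : Measure Ω} {r p : ℝ} {w : ℝ → ℝ}

theorem tsum_kFunctional_le (hq₀ : 0 < q₀) (hq₁ : 0 < q₁) (hq : 0 < q) (hp : 0 < p) (hr : 0 < r)
    (hθ₀ : 0 < θ) (hθ₁ : θ < 1) (hb₀ : IsSV0 q₀ b₀) (hb₁ : IsSV0 q₁ b₁) (hb : Potter b)
    (hw : Potter w) (hmono : MonotoneOn (rho q₀ q₁ b₀ b₁) (Ioi 0))
    (ht : IsGrid q₀ q₁ b₀ b₁ M t) :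
    ∃ C > 0, ∀ f : Ω →ₘ[μ] ℝ,
      ∑' k, ENNReal.ofReal (kWeight θ q b (rho q₀ q₁ b₀ b₁ (t k))) *
        kFunctional (gammaNorm r q₀ p b₀ w) (gammaNorm r q₁ p b₁ w)
          (rho q₀ q₁ b₀ b₁ (t k)) f ^ q ≤
      ENNReal.ofReal C * ∑' k, ENNReal.ofReal (jointWeight q₀ q₁ q θ b₀ b₁ b (t k)) *
        innerNorm r p w f (t k) ^ q := by
  obtain ⟨C, hC, H⟩ := kFunctional_rho_le (μ := μ) hq₀ hq₁ hr hp hb₀ hb₁ hw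
  obtain ⟨C₀, hC₀, H₀⟩ := tsum_lower_le (θ := θ) hq₀ hq₁ hq hθ₀ hb₀ hb₁ hb ht
  obtain ⟨C₁, hC₁, H₁⟩ := tsum_upper_le (θ := θ) hq₀ hq₁ hq hθ₁ hb₀ hb₁ hb hmono ht
  refine ⟨(2 * C) ^ q * (C₀ + C₁), by positivity, fun f => ?_⟩
  set F := innerNorm r p w f with hFdef
  have hF : Monotone F := innerNorm_monotone hr f
  set X : ℤ → ℝ≥0∞ := fun k =>
    ∫⁻ u in Ioc 0 (t k), ENNReal.ofReal (b₀ u ^ q₀ / u) * F u ^ q₀ with hX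
  set Y : ℤ → ℝ≥0∞ := fun k =>
    ∫⁻ u in Ioi (t k), ENNReal.ofReal (b₁ u ^ q₁ / u) * F u ^ q₁ with hY
  set R : ℤ → ℝ := fun k => rho q₀ q₁ b₀ b₁ (t k) with hR
  have hR0 : ∀ k, 0 < R k := fun k => rho_pos hq₀ hq₁ hb₀ hb₁ (ht.pos k)
  have hterm : ∀ k, kFunctional (gammaNorm r q₀ p b₀ w) (gammaNorm r q₁ p b₁ w) (R k) f ^ q ≤
      ENNReal.ofReal ((2 * C) ^ q) *
        (X k ^ (q / q₀) + ENNReal.ofReal (R k ^ q) * Y k ^ (q / q₁)) := by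
    intro k
    have hRk := hR0 k
    calc _ ≤ (ENNReal.ofReal C * (X k ^ (1 / q₀) + ENNReal.ofReal (R k) * Y k ^ (1 / q₁))) ^ q :=
          ENNReal.rpow_le_rpow (H f (t k) (ht.pos k)) hq.le
      _ ≤ ENNReal.ofReal C ^ q * (2 ^ q * ((X k ^ (1 / q₀)) ^ q +
            (ENNReal.ofReal (R k) * Y k ^ (1 / q₁)) ^ q)) := by
          rw [ENNReal.mul_rpow_of_nonneg _ _ hq.le]
          gcongr
          exact rpow_add_le_two_rpow_mul hq.le _ _
      _ = _ := by
          rw [ENNReal.mul_rpow_of_nonneg _ _ hq.le, ← ENNReal.rpow_mul, ← ENNReal.rpow_mul,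
            one_div_mul_eq_div, one_div_mul_eq_div, ENNReal.ofReal_rpow_of_pos hRk,
            ← ENNReal.ofReal_rpow_of_pos (x := 2 * C) (by positivity), ENNReal.ofReal_mul two_pos.le,
            ENNReal.mul_rpow_of_nonneg _ _ hq.le, ENNReal.ofReal_ofNat]
          ring
  calc _ ≤ ∑' k, ENNReal.ofReal (kWeight θ q b (R k)) * (ENNReal.ofReal ((2 * C) ^ q) *
        (X k ^ (q / q₀) + ENNReal.ofReal (R k ^ q) * Y k ^ (q / q₁))) := by
        gcongr with k
        exact hterm k
    _ = ENNReal.ofReal ((2 * C) ^ q) * (∑' k, ENNReal.ofReal (kWeight θ q b (R k)) *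
          X k ^ (q / q₀) +
          ∑' k, ENNReal.ofReal (kWeight θ q b (R k) * R k ^ q) * Y k ^ (q / q₁)) := by
        rw [← ENNReal.tsum_add, ← ENNReal.tsum_mul_left]
        congr 1 with k
        rw [ENNReal.ofReal_mul (kWeight_pos hb (hR0 k)).le]
        ring
    _ ≤ ENNReal.ofReal ((2 * C) ^ q) * (ENNReal.ofReal C₀ *
          (∑' k, ENNReal.ofReal (jointWeight q₀ q₁ q θ b₀ b₁ b (t k)) * F (t k) ^ q) +
          ENNReal.ofReal C₁ *
          ∑' k, ENNReal.ofReal (jointWeight q₀ q₁ q θ b₀ b₁ b (t k)) * F (t k) ^ q) := by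
        gcongr
        · exact H₀ F hF
        · exact H₁ F hF
    _ = _ := by
        rw [ENNReal.ofReal_mul (by positivity), ENNReal.ofReal_add hC₀.le hC₁.le]
        ring

theorem le_tsum_kFunctional (hq₀ : 0 < q₀) (hq₁ : 0 < q₁) (hq : 0 < q) (hr : 0 < r)
    (hb₀ : IsSV0 q₀ b₀) (hb₁ : IsSV0 q₁ b₁) (hb : Potter b)
    (hw : IsSV w) (ht : IsGrid q₀ q₁ b₀ b₁ M t) :
    ∃ c > 0, ∀ f : Ω →ₘ[μ] ℝ,
      ENNReal.ofReal c * ∑' k, ENNReal.ofReal (jointWeight q₀ q₁ q θ b₀ b₁ b (t k)) *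
        innerNorm r p w f (t k) ^ q ≤
      ∑' k, ENNReal.ofReal (kWeight θ q b (rho q₀ q₁ b₀ b₁ (t k))) *
        kFunctional (gammaNorm r q₀ p b₀ w) (gammaNorm r q₁ p b₁ w)
          (rho q₀ q₁ b₀ b₁ (t k)) f ^ q := by
  obtain ⟨c, hc, H⟩ := le_kFunctional_rho (μ := μ) (p := p) hq₀ hq₁ hr hb₀ hb₁ hw
  refine ⟨c ^ q, by positivity, fun f => ?_⟩
  rw [← ENNReal.tsum_mul_left]
  refine ENNReal.tsum_le_tsum fun k => ?_
  have h0 := tailNorm_pos hq₀ hb₀ (ht.pos k)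
  have hV := kWeight_pos (θ := θ) (q := q) hb (rho_pos hq₀ hq₁ hb₀ hb₁ (ht.pos k))
  calc _ = ENNReal.ofReal (kWeight θ q b (rho q₀ q₁ b₀ b₁ (t k))) *
        (ENNReal.ofReal c * (ENNReal.ofReal (tailNorm q₀ b₀ (t k)) *
          innerNorm r p w f (t k))) ^ q := by
        rw [ENNReal.mul_rpow_of_nonneg _ _ hq.le, ENNReal.mul_rpow_of_nonneg _ _ hq.le,
          ENNReal.ofReal_rpow_of_pos hc, ENNReal.ofReal_rpow_of_pos h0, jointWeight,
          ENNReal.ofReal_mul hV.le]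
        ring
    _ ≤ _ := by
        gcongr
        exact H f (t k) (ht.pos k)

/-- Equivalence of the two quasi-norms. -/
theorem interpNorm_equiv_gammaNorm (hq₀ : 0 < q₀) (hq₁ : 0 < q₁) (hq : 0 < q) (hp : 0 < p)
    (hr : 0 < r) (hθ₀ : 0 < θ) (hθ₁ : θ < 1) (hb₀ : IsSV0 q₀ b₀) (hb₁ : IsSV0 q₁ b₁)
    (hb : Potter b) (hw : IsSV w) (hmono : MonotoneOn (rho q₀ q₁ b₀ b₁) (Ioi 0))
    (ht : IsGrid q₀ q₁ b₀ b₁ M t) :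
    ∃ c > (0 : ℝ), ∃ C > (0 : ℝ), ∀ f : Ω →ₘ[μ] ℝ,
      ENNReal.ofReal c * gammaNorm r q p (bTilde q₀ q₁ q θ b₀ b₁ b) w f ≤
        interpNorm (gammaNorm r q₀ p b₀ w) (gammaNorm r q₁ p b₁ w) θ q b f ∧
      interpNorm (gammaNorm r q₀ p b₀ w) (gammaNorm r q₁ p b₁ w) θ q b f ≤
        ENNReal.ofReal C * gammaNorm r q p (bTilde q₀ q₁ q θ b₀ b₁ b) w f := by
  obtain ⟨c₁, hc₁, C₁, hC₁, H₁⟩ := interpNorm_discrete (θ := θ) hq hb ht.two_le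
    (fun k => rho_pos hq₀ hq₁ hb₀ hb₁ (ht.pos k)) (ht.rho_monotone hq₀ hq₁ hb₀ hb₁)
    (fun x hx => ht.rho_low hx) (ht.rho_up hq₀ hq₁ hb₀ hb₁) ht.two_mul_le ht.le_mul
  obtain ⟨c₂, hc₂, C₂, hC₂, H₂⟩ := bTilde_discrete (θ := θ) hq₀ hq₁ hq hb₀ hb₁ hb hmono ht
  obtain ⟨C₃, hC₃, H₃⟩ := tsum_kFunctional_le (μ := μ) (θ := θ) hq₀ hq₁ hq hp hr hθ₀ hθ₁ hb₀ hb₁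
    hb hw.potter hmono ht
  obtain ⟨c₄, hc₄, H₄⟩ := le_tsum_kFunctional (μ := μ) (θ := θ) (q := q) (p := p) hq₀ hq₁ hq hr
    hb₀ hb₁ hb hw ht
  have hle : ∀ {x y : ℝ≥0∞} {a : ℝ}, 0 < a → ENNReal.ofReal a * x ≤ y →
      x ≤ ENNReal.ofReal a⁻¹ * y := by
    intro x y a ha h
    calc x = ENNReal.ofReal a⁻¹ * (ENNReal.ofReal a * x) := by
          rw [ofReal_mul_ofReal_mul (by positivity), inv_mul_cancel₀ ha.ne', ENNReal.ofReal_one,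
            one_mul]
      _ ≤ _ := by gcongr
  set D : ℝ := C₂ * (c₄⁻¹ * c₁⁻¹) with hD
  have hD0 : 0 < D := by positivity
  refine ⟨(D ^ (1 / q))⁻¹, by positivity, (C₁ * (C₃ * c₂⁻¹)) ^ (1 / q), by positivity,
    fun f => ?_⟩
  have hgamma : gammaNorm r q p (bTilde q₀ q₁ q θ b₀ b₁ b) w f ^ q =
      ∫⁻ u in Ioi 0, ENNReal.ofReal (bTilde q₀ q₁ q θ b₀ b₁ b u ^ q / u) *
        innerNorm r p w f u ^ q := by
    rw [gammaNorm_eq hq fun u hu => bTilde_pos hq₀ hq₁ hb₀ hb₁ hb hu, ← ENNReal.rpow_mul,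
      one_div_mul_cancel hq.ne', ENNReal.rpow_one]
  obtain ⟨h₁, h₁'⟩ := H₁ (gammaNorm (μ := μ) r q₀ p b₀ w) (gammaNorm r q₁ p b₁ w) f
  obtain ⟨h₂, h₂'⟩ := H₂ (innerNorm r p w f) (innerNorm_monotone hr f)
  rw [← hgamma] at h₂ h₂'
  constructor
  · have h : gammaNorm r q p (bTilde q₀ q₁ q θ b₀ b₁ b) w f ^ q ≤ ENNReal.ofReal D *
        interpNorm (gammaNorm r q₀ p b₀ w) (gammaNorm r q₁ p b₁ w) θ q b f ^ q := by
      rw [hD, ENNReal.ofReal_mul hC₂.le, ENNReal.ofReal_mul (by positivity), mul_assoc, mul_assoc]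
      refine h₂'.trans ?_
      gcongr
      refine (hle hc₄ (H₄ f)).trans ?_
      gcongr
      exact hle hc₁ h₁
    have h' := le_ofReal_mul_of_rpow_le hq hD0 h
    calc _ ≤ ENNReal.ofReal (D ^ (1 / q))⁻¹ * (ENNReal.ofReal (D ^ (1 / q)) *
          interpNorm (gammaNorm r q₀ p b₀ w) (gammaNorm r q₁ p b₁ w) θ q b f) := by gcongr
      _ = _ := by
          rw [ofReal_mul_ofReal_mul (by positivity), inv_mul_cancel₀ (by positivity),
            ENNReal.ofReal_one, one_mul]
  · refine le_ofReal_mul_of_rpow_le hq (by positivity) ?_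
    rw [ENNReal.ofReal_mul hC₁.le, ENNReal.ofReal_mul hC₃.le, mul_assoc, mul_assoc]
    refine h₁'.trans ?_
    gcongr
    refine (H₃ f).trans ?_
    gcongr
    exact hle hc₂ h₂

/-- For f outside the sum space the K-functional is an infimum over the empty set, hence ∞ for every
s, and the norm is infinite. -/
theorem mem_sumSet_of_interpNorm_lt_top {V : Type*} [AddCommGroup V] {N₀ N₁ : V → ℝ≥0∞} {f : V}
    (hq : 0 < q) (hb : ∀ s, 0 < s → 0 < b s) (h : interpNorm N₀ N₁ θ q b f < ∞) :
    f ∈ sumSet N₀ N₁ := by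
  by_contra hf
  have htop : ∀ s, kFunctional N₀ N₁ s f = ∞ := fun s => by
    by_contra hs
    exact hf (mem_sumSet_of_kFunctional_lt_top (lt_top_iff_ne_top.2 hs))
  have : interpNorm N₀ N₁ θ q b f = ∞ := by
    rw [interpNorm, lqNorm, setLIntegral_congr_fun (g := fun _ => ∞) measurableSet_Ioi]
    · rw [setLIntegral_const, Real.volume_Ioi, ENNReal.top_mul_top,
        ENNReal.top_rpow_of_pos (by positivity)]
    · intro s hs
      have hs0 : 0 < s := hs
      have := hb s hs0
      simp only
      rw [htop, ENNReal.mul_top (ENNReal.ofReal_pos.2 (by positivity)).ne',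
        ENNReal.top_rpow_of_pos hq]
  exact h.ne this

end Main

end GenGamma

end

theorem mainTheorem11 {Ω : Type*} [MeasurableSpace Ω] (μ : MeasureTheory.Measure Ω)
    [MeasureTheory.SigmaFinite μ]
    (q₀ q₁ q p r θ : ℝ) (hq₀ : 0 < q₀) (hq₁ : 0 < q₁) (hq₀₁ : q₀ ≠ q₁)
    (hq : 0 < q) (hp : 0 < p) (hr : 0 < r) (hθ₀ : 0 < θ) (hθ₁ : θ < 1)
    (b₀ b₁ b w : ℝ → ℝ)
    (hb₀ : GenGamma.IsSV0 q₀ b₀) (hb₁ : GenGamma.IsSV0 q₁ b₁)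
    (hb : GenGamma.IsSV b) (hw : GenGamma.IsSV w)
    (hcond : GenGamma.RhoCondition q₀ q₁ b₀ b₁)
    (hmono : MonotoneOn (GenGamma.rho q₀ q₁ b₀ b₁) (Set.Ioi 0))
    (hzero : Filter.Tendsto (GenGamma.rho q₀ q₁ b₀ b₁) (nhdsWithin 0 (Set.Ioi 0)) (nhds 0))
    (htop : Filter.Tendsto (GenGamma.rho q₀ q₁ b₀ b₁) Filter.atTop Filter.atTop) :
    -- the weight `b̃` is admissible (as soon as `b ∘ ρ` is Lebesgue measurable)
    (AEMeasurable (fun t => b (GenGamma.rho q₀ q₁ b₀ b₁ t))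
        (MeasureTheory.volume.restrict (Set.Ioi 0)) →
      GenGamma.IsSV0 q (GenGamma.bTilde q₀ q₁ q θ b₀ b₁ b)) ∧
    -- the two spaces consist of the same functions
    GenGamma.interpSpace
        (GenGamma.gammaNorm (μ := μ) r q₀ p b₀ w) (GenGamma.gammaNorm (μ := μ) r q₁ p b₁ w) θ q b
      = GenGamma.gammaSpace μ r q p (GenGamma.bTilde q₀ q₁ q θ b₀ b₁ b) w ∧
    -- and their quasi-norms are equivalent
    ∃ c > (0 : ℝ), ∃ C > (0 : ℝ), ∀ f : MeasureTheory.AEEqFun Ω ℝ μ,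
      ENNReal.ofReal c *
          GenGamma.gammaNorm r q p (GenGamma.bTilde q₀ q₁ q θ b₀ b₁ b) w f
        ≤ GenGamma.interpNorm
            (GenGamma.gammaNorm r q₀ p b₀ w) (GenGamma.gammaNorm r q₁ p b₁ w) θ q b f ∧
      GenGamma.interpNorm
          (GenGamma.gammaNorm r q₀ p b₀ w) (GenGamma.gammaNorm r q₁ p b₁ w) θ q b f
        ≤ ENNReal.ofReal C *
          GenGamma.gammaNorm r q p (GenGamma.bTilde q₀ q₁ q θ b₀ b₁ b) w f := by
  have hbP := hb.potter
  obtain ⟨M, t, ht⟩ := GenGamma.exists_grid hq₀ hq₁ hb₀ hb₁ hcond hzero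
  obtain ⟨c, hc, C, hC, H⟩ := GenGamma.interpNorm_equiv_gammaNorm (μ := μ) hq₀ hq₁ hq hp hr hθ₀ hθ₁
    hb₀ hb₁ hbP hw hmono ht
  refine ⟨GenGamma.isSV0_bTilde hq₀ hq₁ hq hθ₀ hb₀ hb₁ hbP hmono ht, ?_, c, hc, C, hC, H⟩
  ext f
  constructor
  · rintro ⟨-, hf⟩
    have h := (H f).1.trans_lt hf
    -- A finite product in [0,∞] has both factors finite or one factor zero; the constant is
    -- nonzero, and a zero gamma norm is finite.
    exact (ENNReal.mul_lt_top_iff.1 h).elim (fun h => h.2) fun h => h.elim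
      (fun h => absurd h (ENNReal.ofReal_pos.2 hc).ne') fun h => by
        change GenGamma.gammaNorm _ _ _ _ _ _ < ⊤
        rw [h]
        exact ENNReal.zero_lt_top
  · intro hf
    have h := (H f).2.trans_lt (ENNReal.mul_lt_top ENNReal.ofReal_lt_top hf)
    exact ⟨GenGamma.mem_sumSet_of_interpNorm_lt_top hq hb.pos h, h⟩
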